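/- Let $n\ge 0$ and let $Y$ be a Young diagram (left-justified rows, weakly decreasing from top to bottom) of size $n$, i.e. with exactly $n$ rows and $n$ columns and containing the staircase with rows $n,n-1,\dots,2,1$. Cells are written $(r,c)$ (row, column), counted from $1$ at the top left corner. For $k\ge 1$ let $St_k=\{(r,c): 1\le r,c\le n,\ r+c\le n+k\}$. A set of cells is connected if any two of its cells can be joined inside the set by a path of cells in which consecutive cells share an edge. The critical staircase of $Y$ is $St_k$ for the least $k\ge1$ for which $Y\setminus St_k$ has at least two connected components. Suppose that such a $k$ exists, and let $St_k^1,\dots,St_k^l$ be the components of $Y\setminus St_k$, numbered from the bottom left corner of $Y$ towards the top right, so that $Y=(Y\cap St_k)\cup\bigcup_{j=1}^l St_k^j$ (the critical decomposition of $Y$; when $St_k\subseteq Y$ it reads $Y=St_k\cup\bigcup_j St_k^j$). A transversal of $Y$ is a set of cells of $Y$ (the $1$'s) with exactly one cell in each row and each column. It contains $(213)$ if it has $1$'s in columns $c_1<c_2<c_3$ and rows $r_1,r_2,r_3$ respectively (rows counted from the top) with $r_3<r_1<r_2$ and with all cells $(r_a,c_b)$, $1\le a,b\le 3$, in $Y$;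 otherwise it avoids $(213)$. Let $\mathcal T(Y)$ be the number of transversals of $Y$ avoiding $(213)$. Let $\tau\in S_l$ and let $t_1,\dots,t_l$ each be either "transpose" (reflect by $(r,c)\mapsto(c,r)$) or "identity". Then there is a Young diagram $Y'$ of size $n$ with $Y'\cap St_k=Y\cap St_k$ such that $Y'\setminus St_k$ has exactly $l$ connected components which, numbered from the bottom left corner, are translates of $(St_k^{\tau(1)})^{t_1},\dots,(St_k^{\tau(l)})^{t_l}$, in this order. Moreover, for every such $Y'$, the critical staircase of $Y'$ is again $St_k$, and $\mathcal T(Y')=\mathcal T(Y)$. -/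

import Mathlib

open scoped Classical

/-- `Y` has size `n`: it has `n` rows and `n` columns and contains every cell on or above the
main antidiagonal. A cell is a pair (row, column), counted from `0` at the top left corner. -/
def YoungDiagram.HasSize (Y : YoungDiagram) (n : ℕ) : Prop :=
  Y.colLen 0 = n ∧ Y.rowLen 0 = n ∧ ∀ i j : ℕ, i + j < n → (i, j) ∈ Y

/-- A transversal of `Y`: a set of cells of `Y` (the cells holding a `1`) which meets every row and
every column of `Y` exactly once. -/
def YoungDiagram.IsTransversal (Y : YoungDiagram) (T : Finset (ℕ × ℕ)) : Prop :=
  T ⊆ Y.cells ∧ (∀ i < Y.colLen 0, ∃! j, (i, j) ∈ T) ∧ (∀ j < Y.rowLen 0, ∃! i, (i, j) ∈ T)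

/-- The filling `T` of `Y` contains the pattern `π`: some `m` ones of `T`, in the rows `r a` and the
columns `c a` (listed from left to right), have heights ordered as the values of `π`, and all the
rows and columns through these ones intersect inside `Y`. Rows are counted from the top, so that a
greater height is a smaller row index. -/
def YoungDiagram.ContainsPattern (Y : YoungDiagram) (T : Finset (ℕ × ℕ)) {m : ℕ}
    (π : Equiv.Perm (Fin m)) : Prop :=
  ∃ r c : Fin m → ℕ, StrictMono c ∧ (∀ a b, r b < r a ↔ π a < π b) ∧
    (∀ a, (r a, c a) ∈ T) ∧ ∀ a b, (r a, c b) ∈ Y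

/-- The number of transversals of `Y` which avoid the pattern `π`. -/
noncomputable def YoungDiagram.numAvoiding (Y : YoungDiagram) {m : ℕ}
    (π : Equiv.Perm (Fin m)) : ℕ :=
  (Y.cells.powerset.filter fun T => Y.IsTransversal T ∧ ¬ Y.ContainsPattern T π).card

/-- The permutation `(213)`, acting on `{0, 1, 2}`. -/
def pattern213 : Equiv.Perm (Fin 3) := Equiv.swap 0 1

/-- The `k`-staircase of size `n`: the cells of the `n × n` square on or above the antidiagonal,
together with the `k - 1` diagonals below it. -/
def staircase (n k : ℕ) : Set (ℕ × ℕ) :=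
  {p | p.1 < n ∧ p.2 < n ∧ p.1 + p.2 + 2 ≤ n + k}

/-- The connected components of a set `X` of cells; two cells are adjacent when they share an edge,
which is the covering relation of the product order on `ℕ × ℕ`. -/
def cellComponents (X : Set (ℕ × ℕ)) : Set (Set (ℕ × ℕ)) :=
  Set.range fun K : ((SimpleGraph.hasse (ℕ × ℕ)).induce X).ConnectedComponent =>
    Subtype.val '' K.supp

/-- The components of the complement `Y \ St_k`. -/
def YoungDiagram.hangingComponents (Y : YoungDiagram) (n k : ℕ) : Set (Set (ℕ × ℕ)) :=
  cellComponents ((Y.cells : Set (ℕ × ℕ)) \ staircase n k)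

/-- `St_k` is the critical staircase of `Y`: the first staircase (`k = 1, 2, …`) whose complement in
`Y` has at least two connected components. -/
def YoungDiagram.IsCritical (Y : YoungDiagram) (n k : ℕ) : Prop :=
  IsLeast {k' : ℕ | 1 ≤ k' ∧ (Y.hangingComponents n k').Nontrivial} k

/-- `S` lists the components of `Y \ St_k` in order, starting at the bottom left corner of `Y`. -/
def YoungDiagram.IsComponentList (Y : YoungDiagram) (n k : ℕ) {l : ℕ}
    (S : Fin l → Set (ℕ × ℕ)) : Prop :=
  Set.range S = Y.hangingComponents n k ∧
    ∀ a b : Fin l, a < b → ∀ p ∈ S a, ∀ q ∈ S b, q.1 < p.1 ∧ p.2 < q.2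

/-- Two sets of cells are translates of each other. -/
def IsTranslate (A B : Set (ℕ × ℕ)) : Prop :=
  ∃ v w : ℕ × ℕ, (fun p => p + v) '' A = (fun p => p + w) '' B

/-- The transpose of the set of cells `A` if `t` is true, and `A` itself otherwise. -/
def transposeIf (t : Bool) (A : Set (ℕ × ℕ)) : Set (ℕ × ℕ) :=
  if t then Prod.swap '' A else A

/-- `Y'` is a Young diagram of size `n` which has the same cells as `Y` in `St_k`, and in which
the components of `Y' \ St_k`, in order from the bottom left corner, are
`(S (τ 0))^{t 0}, (S (τ 1))^{t 1}, …`, up to translation. -/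
def YoungDiagram.IsRearrangement (Y' Y : YoungDiagram) (n k : ℕ) {l : ℕ}
    (S : Fin l → Set (ℕ × ℕ)) (τ : Equiv.Perm (Fin l)) (t : Fin l → Bool) : Prop :=
  Y'.HasSize n ∧
    (Y'.cells : Set (ℕ × ℕ)) ∩ staircase n k = (Y.cells : Set (ℕ × ℕ)) ∩ staircase n k ∧
    ∃ S' : Fin l → Set (ℕ × ℕ), Y'.IsComponentList n k S' ∧
      ∀ j, IsTranslate (S' j) (transposeIf (t j) (S (τ j)))

/-! Followed from the bottom left corner, the boundary of `Y` is a Dyck word: a horizontal step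
opens a column, a vertical step closes the lowest live row. A `(213)`-avoiding transversal is built
along it, each new column receiving its 1 in a new row inserted among the live ones. The new 1 can
only be the 3 of a pattern, so the sole condition is that the live 1's below it, read upwards, stand
in increasing columns. Hence only the lengths of the ascending runs of live columns matter, and the
two kinds of steps act as linear operators `columnOp` and `rowOp` on functions of these lengths
(`sum_avoiders`).

The crux is `columnOp_cutOp_pow_rowOp`: with C = `cutOp`, the composite `columnOp ∘ C^q ∘ rowOp`
equals 1 + C + ⋯ + C^(q+1). By induction every Dyck word acts as a polynomial in the single operator
C, and such operators commute. The polynomial of a plane forest is therefore the product over its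
trees, each tree contributing `nestPoly` of its child forest, and the order of siblings is lost. As
C kills the empty state, the number of avoiders is the constant term of this polynomial.

Geometrically, trees are the connected components of the part of `Y` from an antidiagonal on, and
passing to the child forest strips the lowest antidiagonal. The resulting recursion `hangPoly` uses
only adjacency and the comparison of r + c, so it is blind to translation and reflection
(`hangPoly_image`). Before the critical staircase each stage has a single component; thus the number
of avoiders is the value at 1 of `nestPoly` iterated k - 1 times on a product over the components
(`numAvoiding_eq_of_isCritical`), which a rearrangement preserves.

That `Y'` has the same critical staircase follows from a connectivity criterion which only counts
cells on two consecutive antidiagonals (`subsingleton_iff`). A rearrangement is constructed by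
packing the moved components side by side along the antidiagonal. -/

/-! ### Operators on run lengths -/

open Polynomial in
/-- The linear map on polynomials sending `X ^ q` to `1 + X + ⋯ + X ^ (q + 1)`. -/
noncomputable def nestPoly : ℕ[X] →ₗ[ℕ] ℕ[X] :=
  Polynomial.lsum fun q => LinearMap.toSpanSingleton ℕ ℕ[X] (∑ i ∈ Finset.range (q + 2), X ^ i)

/-- Sum over the ways of inserting a new last column into a state. A state lists the lengths, minus
one, of the ascending runs of the live columns, read from the lowest live row upwards. -/
def columnOp : (List ℕ → ℕ) →ₗ[ℕ] (List ℕ → ℕ) where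
  toFun φ
    | [] => φ [0]
    | p :: r => φ ((p + 1) :: r) + ∑ a ∈ Finset.range (p + 1), φ (a :: (p - a) :: r)
  map_add' φ ψ := by
    funext s
    cases s <;> simp [Finset.sum_add_distrib, add_add_add_comm]
  map_smul' m φ := by
    funext s
    cases s <;> simp [Finset.mul_sum, mul_add]

/-- Removing the lowest live row from a state. -/
def dropRow : List ℕ → List ℕ
  | [] => []
  | 0 :: r => r
  | (p + 1) :: r => p :: r

/-- Precomposition with `dropRow`. -/
def rowOp : (List ℕ → ℕ) →ₗ[ℕ] (List ℕ → ℕ) where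
  toFun φ s := φ (dropRow s)
  map_add' _ _ := rfl
  map_smul' _ _ := rfl

/-- Sum over the ways of cutting the first run of a state, the trivial cut included. -/
def cutOp : Module.End ℕ (List ℕ → ℕ) where
  toFun φ
    | [] => 0
    | p :: r => φ (p :: r) + ∑ a ∈ Finset.range p, φ (a :: (p - 1 - a) :: r)
  map_add' φ ψ := by
    funext s
    cases s <;> simp [Finset.sum_add_distrib, add_add_add_comm]
  map_smul' m φ := by
    funext s
    cases s <;> simp [Finset.mul_sum, mul_add]

theorem cutOp_nil (φ : List ℕ → ℕ) : cutOp φ [] = 0 := rfl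

theorem cutOp_cons (φ : List ℕ → ℕ) (p : ℕ) (r : List ℕ) :
    cutOp φ (p :: r) = φ (p :: r) + ∑ a ∈ Finset.range p, φ (a :: (p - 1 - a) :: r) := rfl

theorem columnOp_nil (φ : List ℕ → ℕ) : columnOp φ [] = φ [0] := rfl

theorem columnOp_cons (φ : List ℕ → ℕ) (p : ℕ) (r : List ℕ) :
    columnOp φ (p :: r) =
      φ ((p + 1) :: r) + ∑ a ∈ Finset.range (p + 1), φ (a :: (p - a) :: r) := rfl

theorem cutOp_pow_rowOp_zero (q : ℕ) (φ : List ℕ → ℕ) (r : List ℕ) :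
    (cutOp ^ q) (rowOp φ) (0 :: r) = φ r := by
  induction q with
  | zero => rfl
  | succ q ih => rw [pow_succ', Module.End.mul_apply, cutOp_cons]; simpa using ih

/-- Induction on the number of cuts. A cut which isolates the lowest element leaves a run of length
one, where later cuts are idle and which the row removal deletes: this gives the term i = 0. All
other cuts are cuts of the run that remains after the removal, and they raise the exponent by one.
-/
theorem cutOp_pow_rowOp_succ (q : ℕ) (φ : List ℕ → ℕ) (p : ℕ) (r : List ℕ) :
    (cutOp ^ q) (rowOp φ) ((p + 1) :: r) =
      ∑ i ∈ Finset.range (q + 1), (cutOp ^ i) φ (p :: r) := by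
  induction q generalizing p r with
  | zero => simp [rowOp, dropRow]
  | succ q ih =>
    rw [pow_succ', Module.End.mul_apply, cutOp_cons, ih, Finset.sum_range_succ' _ p,
      cutOp_pow_rowOp_zero, Finset.sum_range_succ' _ (q + 1)]
    simp only [ih, pow_succ', Module.End.mul_apply, cutOp_cons, Finset.sum_add_distrib]
    rw [Finset.sum_comm, ← add_assoc]
    congr 1
    · congr 1
      refine Finset.sum_congr rfl fun i _ => Finset.sum_congr rfl fun a _ => ?_
      rw [show p + 1 - 1 - (a + 1) = p - 1 - a by omega]

/-- Inserting the new element at the very bottom makes it a run of its own, which the row removal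
deletes again: this is the term i = 0. The other insertions, once the lowest element is removed, run
exactly through the cuts of the original first run, which supplies one more factor `cutOp`. On the
empty state only i = 0 survives. -/
theorem columnOp_cutOp_pow_rowOp (q : ℕ) (φ : List ℕ → ℕ) (s : List ℕ) :
    columnOp ((cutOp ^ q) (rowOp φ)) s = ∑ i ∈ Finset.range (q + 2), (cutOp ^ i) φ s := by
  rw [Finset.sum_range_succ']
  cases s with
  | nil =>
    rw [columnOp_nil, cutOp_pow_rowOp_zero]
    simp [pow_succ', cutOp_nil]
  | cons p r =>
    rw [columnOp_cons, cutOp_pow_rowOp_succ, Finset.sum_range_succ' _ p, cutOp_pow_rowOp_zero]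
    simp only [cutOp_pow_rowOp_succ, pow_succ', Module.End.mul_apply, cutOp_cons,
      Finset.sum_add_distrib]
    rw [Finset.sum_comm, ← add_assoc]
    congr 1
    · congr 1
      refine Finset.sum_congr rfl fun i _ => Finset.sum_congr rfl fun a _ => ?_
      rw [show p - (a + 1) = p - 1 - a by omega]

open Polynomial in
theorem nestPoly_monomial (q a : ℕ) :
    nestPoly (monomial q a) = a • ∑ i ∈ Finset.range (q + 2), X ^ i := by
  simp [nestPoly, lsum_apply]

open Polynomial in
theorem aeval_nestPoly (f : ℕ[X]) (φ : List ℕ → ℕ) :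
    aeval cutOp (nestPoly f) φ = columnOp (aeval cutOp f (rowOp φ)) := by
  induction f using Polynomial.induction_on' with
  | add f g hf hg => simp only [map_add, LinearMap.add_apply, hf, hg]
  | monomial q a =>
    funext s
    rw [nestPoly_monomial, map_nsmul, aeval_monomial]
    simp only [map_sum, map_pow, aeval_X, LinearMap.smul_apply, Module.End.mul_apply,
      Module.algebraMap_end_apply, map_smul, Pi.smul_apply, columnOp_cutOp_pow_rowOp,
      LinearMap.sum_apply, Finset.sum_apply]

open Polynomial in
theorem eval_zero_nestPoly (f : ℕ[X]) : (nestPoly f).eval 0 = f.eval 1 := by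
  induction f using Polynomial.induction_on' with
  | add f g hf hg => simp only [map_add, eval_add, hf, hg]
  | monomial q a => simp [nestPoly_monomial, eval_finsetSum, Finset.sum_range_succ']

open Polynomial in
-- The empty state has no run to cut, so every positive power of `cutOp` vanishes there.
theorem aeval_cutOp_nil (f : ℕ[X]) (φ : List ℕ → ℕ) :
    aeval cutOp f φ [] = f.eval 0 * φ [] := by
  induction f using Polynomial.induction_on' with
  | add f g hf hg => simp only [map_add, eval_add, LinearMap.add_apply, Pi.add_apply, hf, hg, add_mul]
  | monomial q a =>
    rw [aeval_monomial]
    cases q with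
    | zero => simp
    | succ q => simp [pow_succ', cutOp_nil, Module.End.mul_apply]

/-! ### Plane forests and the operators of their Dyck words -/

/-- Plane forests, in the first-child next-sibling encoding. -/
inductive PlaneForest
  | nil : PlaneForest
  | node : PlaneForest → PlaneForest → PlaneForest

namespace PlaneForest

/-- The number of nodes. -/
def size : PlaneForest → ℕ
  | nil => 0
  | node l r => l.size + 1 + r.size

/-- The Dyck word of a plane forest; `true` is an up step. -/
def word : PlaneForest → List Bool
  | nil => []
  | node l r => true :: (l.word ++ false :: r.word)

/-- The polynomial of a plane forest. -/
noncomputable def poly : PlaneForest → Polynomial ℕ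
  | nil => 1
  | node l r => nestPoly l.poly * r.poly

end PlaneForest

/-- The operator of a word: `true` inserts a column, `false` removes a row. -/
def wordOp : List Bool → (List ℕ → ℕ) → (List ℕ → ℕ)
  | [], φ => φ
  | true :: w, φ => columnOp (wordOp w φ)
  | false :: w, φ => rowOp (wordOp w φ)

theorem wordOp_append (u w : List Bool) (φ : List ℕ → ℕ) :
    wordOp (u ++ w) φ = wordOp u (wordOp w φ) := by
  induction u with
  | nil => rfl
  | cons b u ih => cases b <;> simp [wordOp, ih]

/-- Enclosing a word between an up step and its matching down step is `nestPoly`, and concatenation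
is multiplication. Since the target ring is commutative, the order of the trees becomes invisible.
-/
theorem PlaneForest.wordOp_word (t : PlaneForest) (φ : List ℕ → ℕ) :
    wordOp t.word φ = Polynomial.aeval cutOp t.poly φ := by
  induction t generalizing φ with
  | nil => simp [word, poly, wordOp]
  | node l r hl hr =>
    simp only [word, poly, wordOp, wordOp_append, hl, hr, map_mul, Module.End.mul_apply,
      aeval_nestPoly]

theorem PlaneForest.wordOp_word_nil (t : PlaneForest) :
    wordOp t.word 1 [] = t.poly.eval 0 := by
  rw [wordOp_word, aeval_cutOp_nil, Pi.one_apply, mul_one]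

/-! ### Ascending runs and insertion of a new maximum -/

/-- The lengths, minus one, of the maximal ascending runs of a list. -/
def ascRuns : List ℕ → List ℕ
  | [] => []
  | [_] => [0]
  | x :: y :: l => if x < y then ((ascRuns (y :: l)).headI + 1) :: (ascRuns (y :: l)).tail
      else 0 :: ascRuns (y :: l)

theorem ascRuns_cons_ne_nil (x : ℕ) (l : List ℕ) : ascRuns (x :: l) ≠ [] := by
  cases l with
  | nil => simp [ascRuns]
  | cons y l => rw [ascRuns]; split_ifs <;> simp

theorem ascRuns_cons_of_forall_lt {n : ℕ} {l : List ℕ} (h : ∀ x ∈ l, x < n) :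
    ascRuns (n :: l) = 0 :: ascRuns l := by
  cases l with
  | nil => rfl
  | cons y l => rw [ascRuns, if_neg (h y (by simp)).not_gt]

theorem dropRow_ascRuns (l : List ℕ) : dropRow (ascRuns l) = ascRuns l.tail := by
  match l with
  | [] => rfl
  | [_] => rfl
  | x :: y :: l =>
    rw [ascRuns]
    obtain ⟨p, r, h⟩ := List.exists_cons_of_ne_nil (ascRuns_cons_ne_nil y l)
    split_ifs <;> simp [h, dropRow]

/-- A new maximum may be put after k entries only if these are ascending, that is, inside or at the
end of the first run. At the end it lengthens this run; elsewhere it closes the first part of a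
split run. -/
theorem columnOp_ascRuns (n : ℕ) (l : List ℕ) (hl : ∀ x ∈ l, x < n) (φ : List ℕ → ℕ) :
    columnOp φ (ascRuns l) = ∑ k ∈ Finset.range (l.length + 1),
      if (l.take k).Pairwise (· < ·) then φ (ascRuns (l.take k ++ n :: l.drop k)) else 0 := by
  induction l generalizing φ with
  | nil => simp [ascRuns, columnOp_nil]
  | cons x l ih =>
    have hl' : ∀ z ∈ l, z < n := fun z hz => hl z (by simp [hz])
    have hx : x < n := hl x (by simp)
    rw [List.length_cons, Finset.sum_range_succ']
    cases l with
    | nil => simp [ascRuns, columnOp_cons, hx, hx.not_gt]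
    | cons y l =>
      obtain ⟨p, r, h⟩ := List.exists_cons_of_ne_nil (ascRuns_cons_ne_nil y l)
      have h0 : ascRuns (n :: x :: y :: l) = 0 :: ascRuns (x :: y :: l) :=
        ascRuns_cons_of_forall_lt hl
      have hny : ¬ n < y := (hl' y (by simp)).not_gt
      by_cases hxy : x < y
      · have hr : ascRuns (x :: y :: l) = (p + 1) :: r := by rw [ascRuns, if_pos hxy, h]; rfl
        -- When x < y, prepending x lengthens the first run by one; this is absorbed into the test
        -- function.
        have key := ih hl' (fun s => φ ((s.headI + 1) :: s.tail))
        rw [h, columnOp_cons] at key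
        simp only [List.headI_cons, List.tail_cons] at key
        rw [hr, columnOp_cons, Finset.sum_range_succ', ← add_assoc]
        congr 1
        · simp only [Nat.add_sub_add_right]
          rw [key]
          refine Finset.sum_congr rfl fun k _ => ?_
          cases k with
          | zero => simp [ascRuns, hx, hny]
          | succ k =>
            have : (x :: y :: List.take k l).Pairwise (· < ·) ↔
                (y :: List.take k l).Pairwise (· < ·) := by
              rw [List.pairwise_cons, and_iff_right_iff_imp]
              intro h z hz
              rcases List.mem_cons.1 hz with rfl | hz
              · exact hxy
              · exact hxy.trans (List.rel_of_pairwise_cons h hz)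
            simp only [List.take_succ_cons, List.drop_succ_cons, this, List.cons_append]
            rw [ascRuns, if_pos hxy]
        · simp [h0, hr]
      -- The first run is x alone, so only the positions 0 and 1 are allowed.
      · rw [Finset.sum_range_succ', Finset.sum_eq_zero]
        · have hr : ascRuns (x :: y :: l) = 0 :: ascRuns (y :: l) := by rw [ascRuns, if_neg hxy]
          simp only [List.take_succ_cons, List.take_zero, List.drop_succ_cons, List.drop_zero,
            List.nil_append, List.cons_append, h0, hr, columnOp_cons]
          simp [ascRuns, hx, hny]
        · intro k _
          rw [if_neg]
          simp [hxy]

/-! ### Shapes of words and the recursion for their avoiders -/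

/-- The cell `p` lies in a column of the word `w` (above an up step of `w`), when the lattice path
starts at the lower end of `i` rows and at the left end of column `j`. -/
def wordMem : List Bool → ℕ → ℕ → ℕ × ℕ → Prop
  | [], _, _, _ => False
  | true :: w, i, j, p => (p.2 = j ∧ p.1 < i) ∨ wordMem w i (j + 1) p
  | false :: w, i, j, p => wordMem w (i - 1) j p

theorem wordMem_append (u w : List Bool) (i j : ℕ) (p : ℕ × ℕ) :
    wordMem (u ++ w) i j p ↔
      wordMem u i j p ∨ wordMem w (i - u.count false) (j + u.count true) p := by
  induction u generalizing i j with
  | nil => simp [wordMem]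
  | cons b u ih =>
    cases b
    · simp [wordMem, ih, Nat.sub_sub, add_comm]
    · simp [wordMem, ih, or_assoc, add_comm, add_left_comm]

theorem not_wordMem_zero (u : List Bool) (j : ℕ) (p : ℕ × ℕ) : ¬ wordMem u 0 j p := by
  induction u generalizing j with
  | nil => simp [wordMem]
  | cons b u ih => cases b <;> simp [wordMem, ih]

theorem wordMem_succ (u : List Bool) (i j r c : ℕ) :
    wordMem u (i + 1) j (r + 1, c) ↔ wordMem u i j (r, c) := by
  induction u generalizing i j with
  | nil => simp [wordMem]
  | cons b u ih =>
    cases b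
    · cases i with
      | zero => simp [wordMem, not_wordMem_zero]
      | succ i => simpa [wordMem] using ih i j
    · simp [wordMem, ih]

theorem wordMem_lt {u : List Bool} {i j : ℕ} {p : ℕ × ℕ} (h : wordMem u i j p) :
    p.2 < j + u.count true := by
  induction u generalizing i j with
  | nil => simp [wordMem] at h
  | cons b u ih =>
    cases b
    · simpa using ih h
    · rw [List.count_cons_self]
      rcases h with h | h
      · omega
      · have := ih h; omega

theorem wordMem_of_lt {u : List Bool} {i j r c : ℕ} (hj : j ≤ c) (hc : c < j + u.count true)
    (hr : r < i - u.count false) : wordMem u i j (r, c) := by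
  induction u generalizing i j with
  | nil => simp at hc; omega
  | cons b u ih =>
    cases b
    · rw [List.count_cons_self] at hr
      exact ih hj (by simpa using hc) (by omega)
    · rw [List.count_cons_self] at hc
      have hr' : r < i - u.count false := by simpa using hr
      by_cases h : c = j
      · left; constructor
        · exact h
        · simp only; omega
      · right; exact ih (by omega) (by omega) hr'

/-- The list `l` of columns, indexed by rows, is a transversal of the shape of the word `u`,
and it avoids `(213)`. -/
structure IsAvoider (u : List Bool) (l : List ℕ) : Prop where
  perm : l.Perm (List.range (u.count true))
  fit : ∀ r c, l[r]? = some c → wordMem u (u.count true) 0 (r, c)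
  avoid : ∀ r₁ r₂ r₃ c₁ c₂ c₃, l[r₁]? = some c₁ → l[r₂]? = some c₂ → l[r₃]? = some c₃ →
    c₁ < c₂ → c₂ < c₃ → r₃ < r₁ → r₁ < r₂ → ¬ wordMem u (u.count true) 0 (r₂, c₃)

theorem isAvoider_append_false (u : List Bool) (l : List ℕ) :
    IsAvoider (u ++ [false]) l ↔ IsAvoider u l := by
  have hc : (u ++ [false]).count true = u.count true := by simp
  have hm (i : ℕ) (p : ℕ × ℕ) : wordMem (u ++ [false]) i 0 p ↔ wordMem u i 0 p := by
    simp [wordMem_append, wordMem]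
  constructor <;> rintro ⟨h₁, h₂, h₃⟩ <;>
    exact ⟨by simpa only [hc] using h₁, by simpa only [hc, hm] using h₂,
      by simpa only [hc, hm] using h₃⟩

theorem wordMem_append_true (u : List Bool) (p : ℕ × ℕ) :
    wordMem (u ++ [true]) (u.count true + 1) 0 p ↔ wordMem u (u.count true + 1) 0 p ∨
      (p.2 = u.count true ∧ p.1 < u.count true + 1 - u.count false) := by
  simp [wordMem_append, wordMem]

theorem getElem?_append_cons_iff {X Y : List ℕ} {a r c : ℕ} :
    (X ++ a :: Y)[r]? = some c ↔ (r < X.length ∧ (X ++ Y)[r]? = some c) ∨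
      (r = X.length ∧ c = a) ∨ ∃ r', r = r' + 1 ∧ X.length ≤ r' ∧ (X ++ Y)[r']? = some c := by
  rcases lt_trichotomy r X.length with h | rfl | h
  · rw [List.getElem?_append_left h, List.getElem?_append_left h]
    constructor
    · exact fun h' => Or.inl ⟨h, h'⟩
    · rintro (h' | h' | ⟨r', h'⟩) <;> [exact h'.2; omega; omega]
  · simp only [List.getElem?_append_right le_rfl, Nat.sub_self, List.getElem?_cons_zero,
      Option.some_inj]
    constructor
    · exact fun h => Or.inr (Or.inl ⟨trivial, h.symm⟩)
    · rintro (h' | h' | ⟨r', h'⟩) <;> [omega; exact h'.2.symm; omega]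
  · obtain ⟨r, rfl⟩ : ∃ s, r = s + 1 := ⟨r - 1, by omega⟩
    rw [List.getElem?_append_right (by omega), Nat.sub_add_comm (by omega), List.getElem?_cons_succ,
      ← List.getElem?_append_right (by omega)]
    constructor
    · exact fun h' => Or.inr (Or.inr ⟨r, rfl, by omega, h'⟩)
    · rintro (h' | h' | ⟨r', h', _, h''⟩) <;> [omega; omega; skip]
      obtain rfl : r = r' := by omega
      exact h''

/-- The new 1 lies in the last column and in the live row `X.length`, and it pushes the rows from
there on down by one. As its column is the largest, it can only be the 3 of a pattern; the 2 and the
1 would then lie below it in live rows, which is what the second condition forbids. -/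
theorem isAvoider_append_true {u : List Bool} {X Y : List ℕ}
    (hX : X.length + u.count false ≤ u.count true) :
    IsAvoider (u ++ [true]) (X ++ u.count true :: Y) ↔ IsAvoider u (X ++ Y) ∧
      ∀ r₁ r₂ c₁ c₂, X.length ≤ r₁ → r₁ < r₂ → r₂ < u.count true - u.count false →
        (X ++ Y)[r₁]? = some c₁ → (X ++ Y)[r₂]? = some c₂ → c₂ < c₁ := by
  set a := u.count true with ha
  have hc : (u ++ [true]).count true = a + 1 := by simp [ha]
  have hperm : (X ++ a :: Y).Perm (List.range (a + 1)) ↔ (X ++ Y).Perm (List.range a) := by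
    rw [List.range_succ, List.Perm.congr_right (List.perm_append_singleton a (List.range a)),
      List.Perm.congr_left List.perm_middle, List.perm_cons]
  have hlt : (X ++ Y).Perm (List.range a) → ∀ r c, (X ++ Y)[r]? = some c → c < a :=
    fun h r c hr => List.mem_range.1 (h.mem_iff.1 (List.mem_of_getElem? hr))
  constructor
  · rintro ⟨h₁, h₂, h₃⟩
    rw [hc] at h₁ h₂ h₃
    rw [hperm] at h₁
    -- The conditional expression is the new index of an old row. Rows above the insertion are live,
    -- so they meet every column of the shape.
    have lift_mem : ∀ r c, c < a → wordMem u a 0 (r, c) →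
        wordMem (u ++ [true]) (a + 1) 0 (if r < X.length then r else r + 1, c) := by
      intro r c hca h
      rw [wordMem_append_true]
      left
      split_ifs with hr
      · exact wordMem_of_lt (Nat.zero_le _) (by omega) (by omega)
      · exact (wordMem_succ _ _ _ _ _).2 h
    have lift_get : ∀ r c, (X ++ Y)[r]? = some c →
        (X ++ a :: Y)[if r < X.length then r else r + 1]? = some c := by
      intro r c h
      rw [getElem?_append_cons_iff]
      split_ifs with hr
      · exact Or.inl ⟨hr, h⟩
      · exact Or.inr (Or.inr ⟨r, rfl, by omega, h⟩)
    refine ⟨⟨h₁, ?_, ?_⟩, ?_⟩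
    · intro r c hr
      have hca := hlt h₁ r c hr
      by_cases h : r < X.length
      · exact wordMem_of_lt (Nat.zero_le _) (by omega) (by omega)
      · have := h₂ _ _ (lift_get r c hr)
        rw [if_neg h, wordMem_append_true, wordMem_succ] at this
        rcases this with h | h
        · exact h
        · exact absurd h.1 hca.ne
    · intro r₁ r₂ r₃ c₁ c₂ c₃ g₁ g₂ g₃ h12 h23 hr1 hr2 hm
      refine h₃ _ _ _ _ _ _ (lift_get _ _ g₁) (lift_get _ _ g₂) (lift_get _ _ g₃) h12 h23 ?_ ?_
        (lift_mem _ _ (hlt h₁ _ _ g₃) hm) <;> split_ifs <;> omega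
    · intro r₁ r₂ c₁ c₂ hr₁ hr hr₂ g₁ g₂
      by_contra! hcc
      rcases hcc.lt_or_eq with hcc | rfl
      · refine h₃ (r₁ + 1) (r₂ + 1) X.length c₁ c₂ a ?_ ?_ ?_ hcc (hlt h₁ _ _ g₂) (by omega)
          (by omega) ?_
        · exact getElem?_append_cons_iff.2 (Or.inr (Or.inr ⟨r₁, rfl, hr₁, g₁⟩))
        · exact getElem?_append_cons_iff.2 (Or.inr (Or.inr ⟨r₂, rfl, by omega, g₂⟩))
        · exact getElem?_append_cons_iff.2 (Or.inr (Or.inl ⟨rfl, rfl⟩))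
        · rw [wordMem_append_true]
          right
          exact ⟨rfl, by simp only; omega⟩
      · have hnd : (X ++ Y).Nodup := h₁.nodup_iff.2 List.nodup_range
        obtain ⟨hl, -⟩ := List.getElem?_eq_some_iff.1 g₁
        have := (List.getElem?_inj hl hnd).1 (g₁.trans g₂.symm)
        omega
  · rintro ⟨⟨h₁, h₂, h₃⟩, h₄⟩
    have hlt := hlt h₁
    refine ⟨?_, ?_, ?_⟩
    · rw [hc, hperm]; exact h₁
    · intro r c h
      rw [hc, wordMem_append_true]
      rcases getElem?_append_cons_iff.1 h with ⟨hr, h⟩ | ⟨rfl, rfl⟩ | ⟨r', rfl, hr, h⟩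
      · left
        have := hlt _ _ h
        exact wordMem_of_lt (Nat.zero_le _) (by omega) (by omega)
      · right
        exact ⟨rfl, by simp only; omega⟩
      · left
        exact (wordMem_succ _ _ _ _ _).2 (h₂ _ _ h)
    · intro r₁ r₂ r₃ c₁ c₂ c₃ g₁ g₂ g₃ h12 h23 hr1 hr2 hm
      rw [hc, wordMem_append_true] at hm
      rw [getElem?_append_cons_iff] at g₁ g₂ g₃
      -- Either the new 1 is the 3 of the pattern, or the whole pattern comes from the old filling.
      by_cases hca : c₃ = a
      · subst hca
        obtain rfl : r₃ = X.length := by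
          rcases g₃ with ⟨_, h⟩ | ⟨h, -⟩ | ⟨_, _, _, h⟩
          · exact absurd (hlt _ _ h) (lt_irrefl _)
          · exact h
          · exact absurd (hlt _ _ h) (lt_irrefl _)
        have hr2' : r₂ < a + 1 - u.count false := by
          rcases hm with h | h
          · have := wordMem_lt h; simp only at this; omega
          · exact h.2
        rcases g₁ with ⟨_, h⟩ | ⟨h, -⟩ | ⟨r₁', rfl, _, g₁⟩ <;> [omega; omega; skip]
        rcases g₂ with ⟨_, h⟩ | ⟨h, -⟩ | ⟨r₂', rfl, _, g₂⟩ <;> [omega; omega; skip]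
        have := h₄ r₁' r₂' c₁ c₂ (by omega) (by omega) (by omega) g₁ g₂
        omega
      · have hc3 : c₃ < a := by
          rcases g₃ with ⟨_, h⟩ | ⟨_, h⟩ | ⟨_, _, _, h⟩
          exacts [hlt _ _ h, absurd h hca, hlt _ _ h]
        have hm' : wordMem u (a + 1) 0 (r₂, c₃) := by
          rcases hm with h | h
          · exact h
          · exact absurd h.1 hca
        have pull : ∀ r c, c < a → ((r < X.length ∧ (X ++ Y)[r]? = some c) ∨
            (r = X.length ∧ c = a) ∨ ∃ r', r = r' + 1 ∧ X.length ≤ r' ∧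
              (X ++ Y)[r']? = some c) → ∃ r', (X ++ Y)[r']? = some c ∧
                r = if r' < X.length then r' else r' + 1 := by
          rintro r c hca (⟨hr, h⟩ | ⟨_, h⟩ | ⟨r', rfl, hr, h⟩)
          · exact ⟨r, h, by rw [if_pos hr]⟩
          · omega
          · exact ⟨r', h, by rw [if_neg (by omega)]⟩
        obtain ⟨s₁, k₁, rfl⟩ := pull _ _ (by omega) g₁
        obtain ⟨s₂, k₂, rfl⟩ := pull _ _ (by omega) g₂
        obtain ⟨s₃, k₃, rfl⟩ := pull _ _ hc3 g₃
        refine h₃ s₁ s₂ s₃ c₁ c₂ c₃ k₁ k₂ k₃ h12 h23 ?_ ?_ ?_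
        · split_ifs at hr1 <;> omega
        · split_ifs at hr2 <;> omega
        · split_ifs at hm' with hs
          · exact wordMem_of_lt (Nat.zero_le _) (by omega) (by omega)
          · exact (wordMem_succ _ _ _ _ _).1 hm'

/-- The avoiders of the shape of the word `u`. -/
noncomputable def avoiders (u : List Bool) : Finset (List ℕ) :=
  (List.range (u.count true)).permutations.toFinset.filter (IsAvoider u)

theorem mem_avoiders {u : List Bool} {l : List ℕ} : l ∈ avoiders u ↔ IsAvoider u l := by
  simp only [avoiders, Finset.mem_filter, List.mem_toFinset, List.mem_permutations,
    and_iff_right_iff_imp]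
  exact fun h => h.perm

theorem pairwise_take_reverse_take_iff {l : List ℕ} {s k : ℕ} (hs : s ≤ l.length) (hk : k ≤ s) :
    ((l.take s).reverse.take k).Pairwise (· < ·) ↔ ∀ r₁ r₂ c₁ c₂, s - k ≤ r₁ → r₁ < r₂ → r₂ < s →
      l[r₁]? = some c₁ → l[r₂]? = some c₂ → c₂ < c₁ := by
  have hl : (l.take s).length = s := by simp [hs]
  rw [List.take_reverse, List.pairwise_reverse, hl, List.pairwise_iff_getElem]
  constructor
  · intro h r₁ r₂ c₁ c₂ h₁ h₂ h₃ g₁ g₂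
    have := h (r₁ - (s - k)) (r₂ - (s - k)) (by simp; omega) (by simp; omega) (by omega)
    obtain ⟨_, rfl⟩ := List.getElem?_eq_some_iff.1 g₁
    obtain ⟨_, rfl⟩ := List.getElem?_eq_some_iff.1 g₂
    simpa [Nat.add_sub_cancel' h₁, Nat.add_sub_cancel' (h₁.trans h₂.le)] using this
  · intro h i j hi hj hij
    simp only [List.length_drop, hl] at hi hj
    refine h (s - k + i) (s - k + j) _ _ (by omega) (by omega) (by omega) ?_ ?_ <;>
    · rw [List.getElem?_eq_some_iff]
      exact ⟨by omega, by simp⟩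

/-- An avoider of the longer shape is an old avoider together with an admissible row for the new 1,
and `columnOp_ascRuns` sums over these rows. -/
theorem sum_avoiders_append_true (u : List Bool) (hu : u.count false ≤ u.count true)
    (φ : List ℕ → ℕ) :
    ∑ l ∈ avoiders (u ++ [true]),
        φ (ascRuns (l.take ((u ++ [true]).count true - (u ++ [true]).count false)).reverse) =
      ∑ l ∈ avoiders u,
        columnOp φ (ascRuns (l.take (u.count true - u.count false)).reverse) := by
  set a := u.count true with ha
  set s := a - u.count false with hs
  have hs' : (u ++ [true]).count true - (u ++ [true]).count false = s + 1 := by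
    simp only [List.count_append, List.count_singleton_self, ← ha]
    simp
    omega
  have hlen : ∀ l ∈ avoiders u, l.length = a := fun l hl => by
    simpa using (mem_avoiders.1 hl).perm.length_eq
  have hlt : ∀ l ∈ avoiders u, ∀ x ∈ l, x < a := fun l hl x hx =>
    List.mem_range.1 ((mem_avoiders.1 hl).perm.mem_iff.1 hx)
  have key : ∀ l ∈ avoiders u, columnOp φ (ascRuns (l.take s).reverse) =
      ∑ k ∈ (Finset.range (s + 1)).filter
        (fun k => ((l.take s).reverse.take k).Pairwise (· < ·)),
        φ (ascRuns ((l.take s).reverse.take k ++ a :: (l.take s).reverse.drop k)) := by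
    intro l hl
    have hl' : (l.take s).reverse.length = s := by simp [hlen l hl]; omega
    rw [columnOp_ascRuns a, hl', Finset.sum_filter]
    intro x hx
    exact hlt l hl x (List.mem_of_mem_take (List.mem_reverse.1 hx))
  rw [Finset.sum_congr rfl key, Finset.sum_sigma']
  symm
  have split : ∀ l ∈ avoiders u, ∀ k ≤ s, (l.take (s - k)).length = s - k := fun l hl k hk => by
    rw [List.length_take, hlen l hl]; omega
  -- The index k counts the live rows below the new 1, so among the s live rows it is inserted at
  -- row s - k.
  refine Finset.sum_bij (fun x _ => x.1.take (s - x.2) ++ a :: x.1.drop (s - x.2)) ?_ ?_ ?_ ?_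
  · rintro ⟨l, k⟩ h
    simp only [Finset.mem_sigma, Finset.mem_filter, Finset.mem_range] at h
    obtain ⟨hl, hk, hp⟩ := h
    have hsp := split l hl k (by omega)
    rw [mem_avoiders, isAvoider_append_true (by rw [hsp]; omega), List.take_append_drop, hsp]
    exact ⟨mem_avoiders.1 hl,
      (pairwise_take_reverse_take_iff (by rw [hlen l hl]; omega) (by omega)).1 hp⟩
  · rintro ⟨l, k⟩ h ⟨l', k'⟩ h' heq
    simp only [Finset.mem_sigma, Finset.mem_filter, Finset.mem_range] at h h'
    have hn : ∀ m, a ∉ l.take m := fun m hm => (hlt l h.1 a (List.mem_of_mem_take hm)).false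
    have hn' : ∀ m, a ∉ l.drop m := fun m hm => (hlt l h.1 a (List.mem_of_mem_drop hm)).false
    obtain ⟨h₁, -, h₂⟩ := (List.append_cons_inj_of_notMem (hn _) (hn' _)).1 heq
    have e := congrArg List.length h₁
    rw [split l h.1 k (by omega), split l' h'.1 k' (by omega)] at e
    obtain rfl : k = k' := by omega
    obtain rfl : l = l' := by
      rw [← List.take_append_drop (s - k) l, h₁, h₂, List.take_append_drop]
    rfl
  · intro l' hl'
    have hA := mem_avoiders.1 hl'
    have ha' : a ∈ l' := hA.perm.mem_iff.2 (by simp [ha])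
    obtain ⟨X, Y, rfl⟩ := List.append_of_mem ha'
    have hX : X.length ≤ s := by
      have := hA.fit X.length a (by simp)
      rw [show (u ++ [true]).count true = a + 1 by simp [ha], wordMem_append_true] at this
      rcases this with h | h
      · have := wordMem_lt h; simp only at this; omega
      · have := h.2; simp only at this; omega
    obtain ⟨h₁, h₂⟩ := (isAvoider_append_true (by omega)).1 hA
    have hl := mem_avoiders.2 h₁
    refine ⟨⟨X ++ Y, s - X.length⟩, ?_, ?_⟩
    · simp only [Finset.mem_sigma, Finset.mem_filter, Finset.mem_range]
      refine ⟨hl, by omega, ?_⟩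
      rw [pairwise_take_reverse_take_iff (by rw [hlen _ hl]; omega) (by omega),
        Nat.sub_sub_self hX]
      exact h₂
    · simp [Nat.sub_sub_self hX]
  · rintro ⟨l, k⟩ h
    simp only [Finset.mem_sigma, Finset.mem_filter, Finset.mem_range] at h
    obtain ⟨hl, hk, -⟩ := h
    have hsp := split l hl k (by omega)
    have hl' : (l.take s).length = s := by simp [hlen l hl]; omega
    rw [hs', List.take_append, hsp, show s + 1 - (s - k) = k + 1 by omega, List.take_succ_cons,
      List.take_of_length_le (by omega : (l.take (s - k)).length ≤ s + 1), List.take_reverse,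
      List.drop_reverse, hl', List.take_take, min_eq_left (by omega), List.drop_take,
      show s - (s - k) = k by omega]
    simp

theorem sum_avoiders_append_false (u : List Bool) (φ : List ℕ → ℕ) (hu : u.count false ≤ u.count true) :
    ∑ l ∈ avoiders (u ++ [false]),
        φ (ascRuns (l.take ((u ++ [false]).count true - (u ++ [false]).count false)).reverse) =
      ∑ l ∈ avoiders u,
        rowOp φ (ascRuns (l.take (u.count true - u.count false)).reverse) := by
  have h : avoiders (u ++ [false]) = avoiders u := by
    ext l; rw [mem_avoiders, mem_avoiders, isAvoider_append_false]
  rw [h]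
  refine Finset.sum_congr rfl fun l hl => ?_
  change _ = φ (dropRow _)
  have hl' : l.length = u.count true := by
    simpa using (mem_avoiders.1 hl).perm.length_eq
  rw [dropRow_ascRuns, List.tail_reverse, List.dropLast_eq_take, List.take_take]
  congr 4
  simp only [List.count_append, List.length_take]
  simp
  omega

/-- Induction on the last letter, whose operator is innermost in `wordOp`. The prefix condition
keeps the number of live rows from being a truncated difference. -/
theorem sum_avoiders (u : List Bool) (hu : ∀ v, v <+: u → v.count false ≤ v.count true)
    (φ : List ℕ → ℕ) :
    ∑ l ∈ avoiders u, φ (ascRuns (l.take (u.count true - u.count false)).reverse) =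
      wordOp u φ [] := by
  induction u using List.reverseRecOn generalizing φ with
  | nil =>
    have : avoiders [] = {[]} := by
      ext l
      rw [mem_avoiders, Finset.mem_singleton]
      constructor
      · intro h; simpa using h.perm
      · rintro rfl
        exact ⟨by simp, by simp, by simp⟩
    simp [this, wordOp, ascRuns]
  | append_singleton u b ih =>
    have hu' := hu u (List.prefix_append _ _)
    have ih := ih fun v hv => hu v (hv.trans (List.prefix_append _ _))
    rw [wordOp_append, ← ih]
    cases b
    · exact sum_avoiders_append_false u φ hu'
    · exact sum_avoiders_append_true u hu' φ

theorem card_avoiders (u : List Bool) (hu : ∀ v, v <+: u → v.count false ≤ v.count true) :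
    (avoiders u).card = wordOp u 1 [] := by
  rw [← sum_avoiders u hu]; simp

/-! ### From transversals of a diagram to avoiders of a word -/

/-- The cell (r₂, c₃) is the bottom right corner of the three rows and columns, so its membership
forces that of the other eight. -/
theorem YoungDiagram.containsPattern_pattern213_iff (Y : YoungDiagram) (T : Finset (ℕ × ℕ)) :
    Y.ContainsPattern T pattern213 ↔ ∃ r₁ r₂ r₃ c₁ c₂ c₃, (r₁, c₁) ∈ T ∧ (r₂, c₂) ∈ T ∧
      (r₃, c₃) ∈ T ∧ c₁ < c₂ ∧ c₂ < c₃ ∧ r₃ < r₁ ∧ r₁ < r₂ ∧ (r₂, c₃) ∈ Y := by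
  have h0 : pattern213 0 = 1 := by decide
  have h1 : pattern213 1 = 0 := by decide
  have h2 : pattern213 2 = 2 := by decide
  constructor
  · rintro ⟨r, c, hc, hr, hT, hY⟩
    refine ⟨r 0, r 1, r 2, c 0, c 1, c 2, hT 0, hT 1, hT 2, hc (by decide), hc (by decide),
      (hr 0 2).2 (by rw [h0, h2]; decide), (hr 1 0).2 (by rw [h0, h1]; decide), hY 1 2⟩
  · rintro ⟨r₁, r₂, r₃, c₁, c₂, c₃, h₁, h₂, h₃, hc, hc', hr, hr', hY⟩
    refine ⟨![r₁, r₂, r₃], ![c₁, c₂, c₃], ?_, ?_, ?_, ?_⟩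
    · intro a b hab
      fin_cases a <;> fin_cases b <;> simp at hab ⊢ <;> omega
    · intro a b
      fin_cases a <;> fin_cases b <;> simp [h0, h1, h2] <;> omega
    · intro a
      fin_cases a <;> simpa
    · intro a b
      refine Y.isLowerSet (show (_, _) ≤ (r₂, c₃) from ⟨?_, ?_⟩) hY
      · fin_cases a <;> simp <;> omega
      · fin_cases b <;> simp <;> omega

theorem YoungDiagram.numAvoiding_eq_card_avoiders (Y : YoungDiagram) (u : List Bool)
    (hc : Y.colLen 0 = u.count true) (hr : Y.rowLen 0 = u.count true)
    (hY : ∀ p, p ∈ Y ↔ wordMem u (u.count true) 0 p) :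
    Y.numAvoiding pattern213 = (avoiders u).card := by
  set n := u.count true with hn
  have hrow : ∀ p ∈ Y, p.1 < n := fun p hp => by
    rw [← hc, ← Y.mem_iff_lt_colLen]
    exact Y.up_left_mem le_rfl (Nat.zero_le _) hp
  have hcol : ∀ p ∈ Y, p.2 < n := fun p hp => by
    rw [← hr, ← Y.mem_iff_lt_rowLen]
    exact Y.up_left_mem (Nat.zero_le _) le_rfl hp
  symm
  refine Finset.card_bij (fun l _ => Y.cells.filter fun p => l[p.1]? = some p.2) ?_ ?_ ?_
  · intro l hl
    obtain ⟨h₁, h₂, h₃⟩ := mem_avoiders.1 hl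
    rw [← hn] at h₁ h₂ h₃
    have hm : ∀ r c, (r, c) ∈ Y.cells.filter (fun p => l[p.1]? = some p.2) ↔ l[r]? = some c := by
      intro r c
      simp only [Finset.mem_filter, YoungDiagram.mem_cells, and_iff_right_iff_imp, hY]
      exact h₂ r c
    have hlen : l.length = n := by simpa using h₁.length_eq
    have hnd : l.Nodup := h₁.nodup_iff.2 List.nodup_range
    simp only [Finset.mem_filter, Finset.mem_powerset]
    refine ⟨Finset.filter_subset _ _, ⟨Finset.filter_subset _ _, ?_, ?_⟩, ?_⟩
    · intro i hi
      rw [hc] at hi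
      refine ⟨l[i], (hm _ _).2 (by simp), fun j hj => ?_⟩
      replace hj := (hm _ _).1 hj
      exact ((List.getElem?_eq_some_iff.1 hj).2).symm
    · intro j hj
      rw [hr] at hj
      obtain ⟨i, hi⟩ := List.mem_iff_getElem?.1 (h₁.mem_iff.2 (List.mem_range.2 hj))
      refine ⟨i, (hm _ _).2 hi, fun i' hi' => ?_⟩
      replace hi' := (hm _ _).1 hi'
      obtain ⟨hl', -⟩ := List.getElem?_eq_some_iff.1 hi'
      exact (List.getElem?_inj hl' hnd).1 (hi'.trans hi.symm)
    · rw [YoungDiagram.containsPattern_pattern213_iff]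
      rintro ⟨r₁, r₂, r₃, c₁, c₂, c₃, g₁, g₂, g₃, hc, hc', hr, hr', hm'⟩
      rw [hm] at g₁ g₂ g₃
      exact h₃ _ _ _ _ _ _ g₁ g₂ g₃ hc hc' hr hr' ((hY _).1 hm')
  · intro l hl l' hl' heq
    have h := mem_avoiders.1 hl
    have h' := mem_avoiders.1 hl'
    apply List.ext_getElem?
    have main : ∀ l l' : List ℕ, IsAvoider u l → (Y.cells.filter fun p => l[p.1]? = some p.2) =
        (Y.cells.filter fun p => l'[p.1]? = some p.2) → ∀ r c : ℕ, l[r]? = some c → l'[r]? = some c := by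
      intro l l' h heq r c hrc
      have : (r, c) ∈ Y.cells.filter fun p => l[p.1]? = some p.2 := by
        simp only [Finset.mem_filter, YoungDiagram.mem_cells]
        exact ⟨(hY _).2 (h.fit _ _ hrc), hrc⟩
      rw [heq] at this
      exact (Finset.mem_filter.1 this).2
    intro i
    ext c
    exact ⟨main l l' h heq i c, main l' l h' heq.symm i c⟩
  · intro T hT
    simp only [Finset.mem_filter, Finset.mem_powerset] at hT
    obtain ⟨hsub, ⟨-, hrows, hcols⟩, hav⟩ := hT
    rw [hc] at hrows
    rw [hr] at hcols
    choose! f hf hf' using hrows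
    simp only at hf hf'
    have hTf : ∀ r c, (r, c) ∈ T ↔ r < n ∧ f r = c := by
      intro r c
      constructor
      · intro h
        have := hrow _ (hsub h)
        exact ⟨this, (hf' r this c h).symm⟩
      · rintro ⟨h, rfl⟩
        exact hf r h
    have hl : ∀ r c, ((List.range n).map f)[r]? = some c ↔ (r, c) ∈ T := by
      intro r c
      rw [hTf, List.getElem?_eq_some_iff]
      simp
    refine ⟨(List.range n).map f, ?_, ?_⟩
    · rw [mem_avoiders]
      refine ⟨?_, ?_, ?_⟩
      · rw [← hn]
        refine (List.perm_ext_iff_of_nodup ?_ List.nodup_range).2 ?_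
        · refine List.Nodup.map_on ?_ List.nodup_range
          intro x hx y hy hxy
          rw [List.mem_range] at hx hy
          have h₁ := hf x hx
          have h₂ := hf y hy
          rw [← hxy] at h₂
          exact (hcols (f x) (hcol _ (hsub h₁))).unique h₁ h₂
        · intro c
          rw [List.mem_iff_getElem?, List.mem_range]
          constructor
          · rintro ⟨r, h⟩
            exact hcol _ (hsub ((hl r c).1 h))
          · intro h
            obtain ⟨r, h, -⟩ := hcols c h
            exact ⟨r, (hl r c).2 h⟩
      · intro r c h
        exact (hY _).1 (hsub ((hl r c).1 h))
      · intro r₁ r₂ r₃ c₁ c₂ c₃ g₁ g₂ g₃ hc hc' hr hr' hm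
        rw [hl] at g₁ g₂ g₃
        exact hav ((Y.containsPattern_pattern213_iff T).2
          ⟨r₁, r₂, r₃, c₁, c₂, c₃, g₁, g₂, g₃, hc, hc', hr, hr', (hY _).2 hm⟩)
    · ext ⟨r, c⟩
      simp only [Finset.mem_filter, YoungDiagram.mem_cells, hl]
      exact ⟨fun h => h.2, fun h => ⟨hsub h, h⟩⟩

/-! ### The plane forest of a diagram -/

namespace PlaneForest

theorem count_word (t : PlaneForest) (b : Bool) : t.word.count b = t.size := by
  induction t with
  | nil => rfl
  | node l r hl hr =>
    cases b <;> simp [word, size, hl, hr] <;> omega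

theorem count_take_word (t : PlaneForest) (m : ℕ) :
    (t.word.take m).count false ≤ (t.word.take m).count true := by
  induction t generalizing m with
  | nil => simp [word]
  | node l r hl hr =>
    cases m with
    | zero => simp
    | succ m =>
      rw [word, List.take_succ_cons, List.take_append]
      have := hl m
      rcases le_or_gt m l.word.length with h | h
      · simp [Nat.sub_eq_zero_of_le h]
        omega
      · obtain ⟨k, hk⟩ : ∃ k, m - l.word.length = k + 1 := ⟨m - l.word.length - 1, by omega⟩
        have := hr k
        simp [hk]
        omega

theorem count_prefix_word (t : PlaneForest) (v : List Bool) (h : v <+: t.word) :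
    v.count false ≤ v.count true := by
  rw [List.prefix_iff_eq_take.1 h]
  exact t.count_take_word _

theorem wordMem_node (l r : PlaneForest) (i j : ℕ) (p : ℕ × ℕ) :
    wordMem (node l r).word i j p ↔ (p.2 = j ∧ p.1 < i) ∨ wordMem l.word i (j + 1) p ∨
      wordMem r.word (i - (l.size + 1)) (j + (l.size + 1)) p := by
  simp [word, wordMem, wordMem_append, count_word, Nat.sub_sub, add_comm, add_assoc]

/-- First return decomposition of the boundary path with column heights h. The bounds say that the
path starts at height i or lower and never crosses its starting antidiagonal. -/
theorem exists_forest (m i j : ℕ) (h : ℕ → ℕ) (hh : Antitone h) (hm : m ≤ i)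
    (hb : ∀ c, j ≤ c → c < j + m → h c ≤ i ∧ i + j ≤ h c + c) :
    ∃ t : PlaneForest, t.size = m ∧
      ∀ p, wordMem t.word i j p ↔ j ≤ p.2 ∧ p.2 < j + m ∧ p.1 < h p.2 := by
  induction m using Nat.strong_induction_on generalizing i j with
  | _ m ih =>
    cases m with
    | zero => exact ⟨nil, rfl, fun p => by simp [word, wordMem]; omega⟩
    | succ m =>
      -- The least such q is the number of columns before the path first returns to its
      -- antidiagonal, or all columns if these run out. By minimality the columns strictly between
      -- satisfy the bound one antidiagonal further.
      have hex : ∃ q, 1 ≤ q ∧ (q = m + 1 ∨ h (j + q) + q ≤ i) := ⟨m + 1, by omega, Or.inl rfl⟩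
      obtain ⟨q, ⟨hq1, hq⟩, hmin⟩ : ∃ q, (1 ≤ q ∧ (q = m + 1 ∨ h (j + q) + q ≤ i)) ∧
          ∀ q' < q, ¬ (1 ≤ q' ∧ (q' = m + 1 ∨ h (j + q') + q' ≤ i)) :=
        ⟨Nat.find hex, Nat.find_spec hex, fun _ => Nat.find_min hex⟩
      have hqm : q ≤ m + 1 := by
        by_contra! hlt
        exact hmin _ hlt ⟨by omega, Or.inl rfl⟩
      obtain ⟨l, hl, hlm⟩ := ih (q - 1) (by omega) i (j + 1) (by omega) (by
        intro c hc hc'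
        have h1 := hb c (by omega) (by omega)
        have h2 := hmin (c - j) (by omega)
        rw [Nat.add_sub_cancel' (by omega : j ≤ c)] at h2
        omega)
      obtain ⟨r, hr, hrm⟩ := ih (m + 1 - q) (by omega) (i - q) (j + q) (by omega) (by
        intro c hc hc'
        have h1 := hb c (by omega) (by omega)
        have h2 := hh hc
        omega)
      refine ⟨node l r, by rw [size]; omega, fun p => ?_⟩
      have hj := hb j le_rfl (by omega)
      rw [wordMem_node, hl, Nat.sub_add_cancel hq1, hlm, hrm]
      constructor
      · rintro (⟨rfl, h⟩ | h | h)
        · exact ⟨le_rfl, by omega, by omega⟩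
        · exact ⟨by omega, by omega, h.2.2⟩
        · exact ⟨by omega, by omega, h.2.2⟩
      · rintro ⟨h1, h2, h3⟩
        rcases h1.eq_or_lt with h | h
        · left
          rw [← h] at h3
          exact ⟨h.symm, by omega⟩
        · right
          rcases lt_or_ge p.2 (j + q) with h' | h'
          · exact Or.inl ⟨by omega, by omega, h3⟩
          · exact Or.inr ⟨by omega, by omega, h3⟩

end PlaneForest

theorem YoungDiagram.HasSize.fst_lt {Y : YoungDiagram} {n : ℕ} (hY : Y.HasSize n) {p : ℕ × ℕ}
    (hp : p ∈ Y) : p.1 < n := by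
  rw [← hY.1, ← Y.mem_iff_lt_colLen]
  exact Y.up_left_mem le_rfl (Nat.zero_le _) hp

theorem YoungDiagram.HasSize.snd_lt {Y : YoungDiagram} {n : ℕ} (hY : Y.HasSize n) {p : ℕ × ℕ}
    (hp : p ∈ Y) : p.2 < n := by
  rw [← hY.2.1, ← Y.mem_iff_lt_rowLen]
  exact Y.up_left_mem (Nat.zero_le _) le_rfl hp

theorem YoungDiagram.HasSize.exists_forest {Y : YoungDiagram} {n : ℕ} (hY : Y.HasSize n) :
    ∃ t : PlaneForest, t.size = n ∧ (∀ p, p ∈ Y ↔ wordMem t.word n 0 p) ∧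
      Y.numAvoiding pattern213 = t.poly.eval 0 := by
  obtain ⟨t, ht, htm⟩ := PlaneForest.exists_forest n n 0 Y.colLen
    (fun a b h => Y.colLen_anti a b h) le_rfl (by
      intro c _ hc
      constructor
      · exact (Y.colLen_anti 0 c (Nat.zero_le _)).trans hY.1.le
      · by_contra! h
        have := Y.mem_iff_lt_colLen.1 (hY.2.2 (Y.colLen c) c (by omega))
        omega)
  have hm : ∀ p, p ∈ Y ↔ wordMem t.word n 0 p := by
    rintro ⟨r, c⟩
    rw [htm, Y.mem_iff_lt_colLen]
    refine ⟨fun h => ⟨Nat.zero_le _, ?_, h⟩, fun h => h.2.2⟩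
    have := hY.snd_lt (Y.mem_iff_lt_colLen.2 h)
    simpa using this
  refine ⟨t, ht, hm, ?_⟩
  have hc : t.word.count true = n := by rw [t.count_word, ht]
  rw [Y.numAvoiding_eq_card_avoiders t.word (by rw [hc]; exact hY.1) (by rw [hc]; exact hY.2.1)
    (by rw [hc]; exact hm), card_avoiders _ t.count_prefix_word, t.wordOp_word_nil]

/-! ### Connected components of sets of cells -/

theorem hasse_prod_nat_adj_iff (p q : ℕ × ℕ) : (SimpleGraph.hasse (ℕ × ℕ)).Adj p q ↔
    (p.1 = q.1 ∧ (p.2 + 1 = q.2 ∨ q.2 + 1 = p.2)) ∨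
      (p.2 = q.2 ∧ (p.1 + 1 = q.1 ∨ q.1 + 1 = p.1)) := by
  obtain ⟨a, b⟩ := p
  obtain ⟨c, d⟩ := q
  simp only [SimpleGraph.hasse_adj, Prod.mk_covBy_mk_iff, Nat.covBy_iff_add_one_eq]
  omega

theorem not_hasse_adj_of_lt {p q : ℕ × ℕ} (h₁ : q.1 < p.1) (h₂ : p.2 < q.2) :
    ¬ (SimpleGraph.hasse (ℕ × ℕ)).Adj p q := by
  rw [hasse_prod_nat_adj_iff]; omega

/-- The cells `p` and `q` are joined by a path inside `X`. -/
def CellReach (X : Set (ℕ × ℕ)) (p q : ℕ × ℕ) : Prop :=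
  ∃ (hp : p ∈ X) (hq : q ∈ X),
    ((SimpleGraph.hasse (ℕ × ℕ)).induce X).Reachable ⟨p, hp⟩ ⟨q, hq⟩

namespace CellReach

variable {X Z : Set (ℕ × ℕ)} {p q r : ℕ × ℕ}

theorem refl (hp : p ∈ X) : CellReach X p p := ⟨hp, hp, SimpleGraph.Reachable.refl _⟩

theorem symm (h : CellReach X p q) : CellReach X q p := ⟨h.2.1, h.1, h.2.2.symm⟩

theorem trans (h : CellReach X p q) (h' : CellReach X q r) : CellReach X p r :=
  ⟨h.1, h'.2.1, h.2.2.trans h'.2.2⟩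

theorem of_adj (hp : p ∈ X) (hq : q ∈ X) (h : (SimpleGraph.hasse (ℕ × ℕ)).Adj p q) :
    CellReach X p q :=
  ⟨hp, hq, SimpleGraph.Adj.reachable (G := (SimpleGraph.hasse (ℕ × ℕ)).induce X)
    (u := ⟨p, hp⟩) (v := ⟨q, hq⟩) h⟩

theorem closed (h : CellReach X p q) {A : Set (ℕ × ℕ)} (hp : p ∈ A)
    (hA : ∀ a ∈ A, ∀ b ∈ X, (SimpleGraph.hasse (ℕ × ℕ)).Adj a b → b ∈ A) : q ∈ A := by
  obtain ⟨hpX, hqX, ⟨w⟩⟩ := h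
  have : ∀ (a b : X), ((SimpleGraph.hasse (ℕ × ℕ)).induce X).Walk a b → a.1 ∈ A → b.1 ∈ A := by
    intro a b w
    induction w with
    | nil => exact id
    | cons hab _ ih => exact fun ha => ih (hA _ ha _ (Subtype.prop _) hab)
  exact this _ _ w hp

theorem map (h : CellReach X p q) (f : ℕ × ℕ → ℕ × ℕ) (hf : Set.MapsTo f X Z)
    (ha : ∀ a b, (SimpleGraph.hasse (ℕ × ℕ)).Adj a b →
      (SimpleGraph.hasse (ℕ × ℕ)).Adj (f a) (f b)) : CellReach Z (f p) (f q) := by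
  refine (h.closed (A := {q | q ∈ X ∧ CellReach Z (f p) (f q)}) ⟨h.1, refl (hf h.1)⟩ ?_).2
  exact fun a ⟨haX, har⟩ b hb hab => ⟨hb, har.trans (of_adj (hf haX) (hf hb) (ha _ _ hab))⟩

theorem mono (h : CellReach X p q) (hXZ : X ⊆ Z) : CellReach Z p q :=
  h.map id hXZ fun _ _ => id

end CellReach

theorem mem_cellComponents {X K : Set (ℕ × ℕ)} :
    K ∈ cellComponents X ↔ ∃ p ∈ X, K = {q | CellReach X p q} := by
  have key : ∀ p : X, Subtype.val '' (((SimpleGraph.hasse (ℕ × ℕ)).induce X).connectedComponentMk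
      p).supp = {q | CellReach X p q} := by
    intro p
    ext q
    simp only [Set.mem_image, SimpleGraph.ConnectedComponent.mem_supp_iff,
      SimpleGraph.ConnectedComponent.eq, Subtype.exists, Set.mem_ofPred_eq]
    constructor
    · rintro ⟨a, ha, h, rfl⟩
      exact ⟨p.2, ha, h.symm⟩
    · rintro ⟨hp, hq, h⟩
      exact ⟨q, hq, h.symm, rfl⟩
  constructor
  · rintro ⟨C, rfl⟩
    induction C using SimpleGraph.ConnectedComponent.ind with
    | h v => exact ⟨v, v.2, key v⟩
  · rintro ⟨p, hp, rfl⟩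
    exact ⟨_, key ⟨p, hp⟩⟩

section Components

variable {X K K' : Set (ℕ × ℕ)} {p q : ℕ × ℕ}

theorem cellComponents_finite (hX : X.Finite) : (cellComponents X).Finite := by
  have := hX.to_subtype
  have : Finite ((SimpleGraph.hasse (ℕ × ℕ)).induce X).ConnectedComponent := Quot.finite _
  exact Set.finite_range _

theorem subset_of_mem_cellComponents (hK : K ∈ cellComponents X) : K ⊆ X := by
  obtain ⟨p, hp, rfl⟩ := mem_cellComponents.1 hK
  exact fun q hq => hq.2.1

theorem nonempty_of_mem_cellComponents (hK : K ∈ cellComponents X) : K.Nonempty := by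
  obtain ⟨p, hp, rfl⟩ := mem_cellComponents.1 hK
  exact ⟨p, CellReach.refl hp⟩

theorem exists_mem_cellComponents (hp : p ∈ X) : ∃ K ∈ cellComponents X, p ∈ K :=
  ⟨_, mem_cellComponents.2 ⟨p, hp, rfl⟩, CellReach.refl hp⟩

theorem eq_of_mem_cellComponents (hK : K ∈ cellComponents X) (hp : p ∈ K) :
    K = {q | CellReach X p q} := by
  obtain ⟨a, ha, rfl⟩ := mem_cellComponents.1 hK
  ext q
  exact ⟨fun h => CellReach.trans (CellReach.symm hp) h, fun h => CellReach.trans hp h⟩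

theorem subset_of_closed (hK : K ∈ cellComponents X) {A : Set (ℕ × ℕ)} (hpK : p ∈ K) (hpA : p ∈ A)
    (hA : ∀ a ∈ A, ∀ b ∈ X, (SimpleGraph.hasse (ℕ × ℕ)).Adj a b → b ∈ A) : K ⊆ A := by
  rw [eq_of_mem_cellComponents hK hpK]
  exact fun q hq => hq.closed hpA hA

theorem mem_of_hasse_adj (hK : K ∈ cellComponents X) (hp : p ∈ K) (hq : q ∈ X)
    (h : (SimpleGraph.hasse (ℕ × ℕ)).Adj p q) : q ∈ K := by
  rw [eq_of_mem_cellComponents hK hp]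
  exact CellReach.of_adj (subset_of_mem_cellComponents hK hp) hq h

theorem cellComponents_empty : cellComponents ∅ = ∅ := by
  ext K
  simp [mem_cellComponents]

theorem cellComponents_of_reach (hp : p ∈ X) (h : ∀ q ∈ X, CellReach X p q) :
    cellComponents X = {X} := by
  have : ∀ q ∈ X, {r | CellReach X q r} = X := fun q hq => by
    ext r
    exact ⟨fun hr => hr.2.1, fun hr => (h q hq).symm.trans (h r hr)⟩
  ext K
  rw [mem_cellComponents, Set.mem_singleton_iff]
  constructor
  · rintro ⟨q, hq, rfl⟩
    exact this q hq
  · rintro rfl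
    exact ⟨p, hp, (this p hp).symm⟩

theorem cellComponents_iUnion {ι : Type*} (S : ι → Set (ℕ × ℕ)) (x : ι → ℕ × ℕ)
    (hx : ∀ i, x i ∈ S i) (hS : ∀ i, ∀ q ∈ S i, CellReach (S i) (x i) q)
    (hadj : ∀ i j, i ≠ j → ∀ p ∈ S i, ∀ q ∈ S j, ¬ (SimpleGraph.hasse (ℕ × ℕ)).Adj p q) :
    cellComponents (⋃ i, S i) = Set.range S := by
  have key : ∀ i, ∀ p ∈ S i, {q | CellReach (⋃ i, S i) p q} = S i := by
    intro i p hp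
    ext q
    constructor
    · intro h
      refine CellReach.closed h hp fun a ha b hb hab => ?_
      obtain ⟨j, hj⟩ := Set.mem_iUnion.1 hb
      by_cases hij : i = j
      · exact hij ▸ hj
      · exact absurd hab (hadj i j hij a ha b hj)
    · exact fun hq => ((hS i p hp).symm.trans (hS i q hq)).mono (Set.subset_iUnion S i)
  ext K
  rw [mem_cellComponents]
  constructor
  · rintro ⟨p, hp, rfl⟩
    obtain ⟨i, hi⟩ := Set.mem_iUnion.1 hp
    exact ⟨i, (key i p hi).symm⟩
  · rintro ⟨i, rfl⟩
    exact ⟨x i, Set.mem_iUnion.2 ⟨i, hx i⟩, (key i _ (hx i)).symm⟩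

theorem cellComponents_union {A B : Set (ℕ × ℕ)}
    (h : ∀ p ∈ A, ∀ q ∈ B, ¬ (SimpleGraph.hasse (ℕ × ℕ)).Adj p q) :
    cellComponents (A ∪ B) = cellComponents A ∪ cellComponents B := by
  have key : ∀ A B : Set (ℕ × ℕ), (∀ p ∈ A, ∀ q ∈ B, ¬ (SimpleGraph.hasse (ℕ × ℕ)).Adj p q) →
      ∀ p ∈ A, {q | CellReach (A ∪ B) p q} = {q | CellReach A p q} := by
    intro A B h p hp
    ext q
    refine ⟨fun hq => ?_, fun hq => CellReach.mono hq Set.subset_union_left⟩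
    refine CellReach.closed (A := {q | CellReach A p q}) hq (CellReach.refl hp)
      fun a ha b hb hab => ?_
    rcases hb with hb | hb
    · exact CellReach.trans ha (CellReach.of_adj ha.2.1 hb hab)
    · exact absurd hab (h a ha.2.1 b hb)
  have key' : ∀ p ∈ B, {q | CellReach (A ∪ B) p q} = {q | CellReach B p q} := by
    rw [Set.union_comm]
    exact key B A fun p hp q hq hpq => h q hq p hp hpq.symm
  ext K
  simp only [Set.mem_union, mem_cellComponents]
  constructor
  · rintro ⟨p, hp | hp, rfl⟩
    · exact Or.inl ⟨p, hp, key A B h p hp⟩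
    · exact Or.inr ⟨p, hp, key' p hp⟩
  · rintro (⟨p, hp, rfl⟩ | ⟨p, hp, rfl⟩)
    · exact ⟨p, Or.inl hp, (key A B h p hp).symm⟩
    · exact ⟨p, Or.inr hp, (key' p hp).symm⟩

theorem cellComponents_image (f : ℕ × ℕ → ℕ × ℕ)
    (ha : ∀ a b, (SimpleGraph.hasse (ℕ × ℕ)).Adj (f a) (f b) ↔
      (SimpleGraph.hasse (ℕ × ℕ)).Adj a b) (X : Set (ℕ × ℕ)) :
    cellComponents (f '' X) = (f '' ·) '' cellComponents X := by
  have key : ∀ p ∈ X, {q | CellReach (f '' X) (f p) q} = f '' {q | CellReach X p q} := by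
    intro p hp
    ext q
    constructor
    · intro h
      refine CellReach.closed h ⟨p, CellReach.refl hp, rfl⟩ ?_
      rintro _ ⟨a, har, rfl⟩ _ ⟨b, hb, rfl⟩ hab
      exact ⟨b, CellReach.trans har (CellReach.of_adj har.2.1 hb ((ha a b).1 hab)), rfl⟩
    · rintro ⟨q, hq, rfl⟩
      exact CellReach.map hq f (Set.mapsTo_image f X) fun a b => (ha a b).2
  ext K
  simp only [Set.mem_image, mem_cellComponents]
  constructor
  · rintro ⟨_, ⟨p, hp, rfl⟩, rfl⟩
    exact ⟨_, ⟨p, hp, rfl⟩, (key p hp).symm⟩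
  · rintro ⟨_, ⟨p, hp, rfl⟩, rfl⟩
    exact ⟨f p, ⟨p, hp, rfl⟩, (key p hp).symm⟩

/-- A set of cells is connected if each of its columns rises to the antidiagonal `d`, and each column
but the one numbered `c₀` is linked to its left neighbour just below this antidiagonal. -/
theorem cellReach_of_columns {d c₀ : ℕ} (h₀ : ∀ r c, (r, c) ∈ X → d ≤ r + c ∧ c₀ ≤ c ∧ c ≤ d)
    (h₁ : ∀ r r' c, (r, c) ∈ X → r' ≤ r → d ≤ r' + c → (r', c) ∈ X)
    (h₂ : ∀ r c, (r, c) ∈ X → c₀ < c → (d + 1 - c, c) ∈ X ∧ (d + 1 - c, c - 1) ∈ X) :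
    ∀ p ∈ X, CellReach X (d - c₀, c₀) p := by
  have column : ∀ c m r, (r + m, c) ∈ X → d ≤ r + c → CellReach X (r, c) (r + m, c) := by
    intro c m r
    induction m with
    | zero => exact fun h _ => CellReach.refl h
    | succ m ih =>
      intro h hd
      have h' := h₁ _ (r + m) c h (by omega) (by omega)
      refine (ih h' hd).trans (CellReach.of_adj h' h ?_)
      rw [hasse_prod_nat_adj_iff]
      right
      exact ⟨rfl, Or.inl rfl⟩
  have column' : ∀ c r r', (r', c) ∈ X → r ≤ r' → d ≤ r + c → CellReach X (r, c) (r', c) := by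
    intro c r r' h hr hd
    obtain ⟨m, rfl⟩ := Nat.exists_eq_add_of_le hr
    exact column c m r h hd
  have main : ∀ m r, (r, c₀ + m) ∈ X → CellReach X (d - c₀, c₀) (r, c₀ + m) := by
    intro m
    induction m with
    | zero =>
      intro r h
      have := h₀ _ _ h
      exact column' _ _ _ h (by omega) (by omega)
    | succ m ih =>
      intro r h
      have hb := h₀ _ _ h
      obtain ⟨g₁, g₂⟩ := h₂ _ _ h (by omega)
      refine (ih _ g₂).trans ((CellReach.of_adj g₂ g₁ ?_).trans ?_)
      · rw [hasse_prod_nat_adj_iff]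
        left
        exact ⟨rfl, Or.inl rfl⟩
      · exact (column' _ (d - (c₀ + (m + 1))) _ g₁ (by omega) (by omega)).symm.trans
          (column' _ _ _ h (by omega) (by omega))
  rintro ⟨r, c⟩ h
  have := h₀ _ _ h
  obtain ⟨m, rfl⟩ := Nat.exists_eq_add_of_le this.2.1
  exact main m r h

end Components

/-! ### The polynomial of a hanging set of cells and its symmetries -/

/-- The set of cells `X` without its lowest antidiagonal. -/
def hangCore (X : Set (ℕ × ℕ)) : Set (ℕ × ℕ) :=
  {p ∈ X | ∃ q ∈ X, q.1 + q.2 < p.1 + p.2}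

/-- The polynomial of a set of cells hanging below an antidiagonal, computed by peeling off `f`
antidiagonals. -/
noncomputable def hangPoly : ℕ → Set (ℕ × ℕ) → Polynomial ℕ
  | 0, _ => 1
  | f + 1, X => ∏ᶠ K ∈ cellComponents X, nestPoly (hangPoly f (hangCore K))

theorem hangPoly_empty (f : ℕ) : hangPoly f ∅ = 1 := by
  cases f with
  | zero => rfl
  | succ f => rw [hangPoly, cellComponents_empty]; exact finprod_mem_empty

theorem hangPoly_of_reach {X : Set (ℕ × ℕ)} {p : ℕ × ℕ} (f : ℕ) (hp : p ∈ X)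
    (h : ∀ q ∈ X, CellReach X p q) :
    hangPoly (f + 1) X = nestPoly (hangPoly f (hangCore X)) := by
  rw [hangPoly, cellComponents_of_reach hp h]; exact finprod_mem_singleton

theorem hangPoly_union (f : ℕ) {A B : Set (ℕ × ℕ)} (hA : A.Finite) (hB : B.Finite)
    (h : ∀ p ∈ A, ∀ q ∈ B, q.1 < p.1 ∧ p.2 < q.2) :
    hangPoly f (A ∪ B) = hangPoly f A * hangPoly f B := by
  cases f with
  | zero => simp [hangPoly]
  | succ f =>
    rw [hangPoly, cellComponents_union fun p hp q hq =>
      not_hasse_adj_of_lt (h p hp q hq).1 (h p hp q hq).2]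
    refine finprod_mem_union ?_ (cellComponents_finite hA) (cellComponents_finite hB)
    rw [Set.disjoint_left]
    intro K hKA hKB
    obtain ⟨p, hp⟩ := nonempty_of_mem_cellComponents hKA
    exact (h p (subset_of_mem_cellComponents hKA hp) p
      (subset_of_mem_cellComponents hKB hp)).1.false

theorem hangCore_image (f : ℕ × ℕ → ℕ × ℕ)
    (hf : ∀ p q, (f q).1 + (f q).2 < (f p).1 + (f p).2 ↔ q.1 + q.2 < p.1 + p.2)
    (X : Set (ℕ × ℕ)) : hangCore (f '' X) = f '' hangCore X := by
  ext p
  constructor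
  · rintro ⟨⟨p, hp, rfl⟩, _, ⟨q, hq, rfl⟩, h⟩
    exact ⟨p, ⟨hp, q, hq, (hf p q).1 h⟩, rfl⟩
  · rintro ⟨p, ⟨hp, q, hq, h⟩, rfl⟩
    exact ⟨⟨p, hp, rfl⟩, f q, ⟨q, hq, rfl⟩, (hf p q).2 h⟩

/-- The recursion sees only components and the comparison of antidiagonals, both of which f
respects. -/
theorem hangPoly_image (m : ℕ) (f : ℕ × ℕ → ℕ × ℕ) (hinj : f.Injective)
    (hf : ∀ p q, (f q).1 + (f q).2 < (f p).1 + (f p).2 ↔ q.1 + q.2 < p.1 + p.2)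
    (ha : ∀ a b, (SimpleGraph.hasse (ℕ × ℕ)).Adj (f a) (f b) ↔
      (SimpleGraph.hasse (ℕ × ℕ)).Adj a b) (X : Set (ℕ × ℕ)) :
    hangPoly m (f '' X) = hangPoly m X := by
  induction m generalizing X with
  | zero => rfl
  | succ m ih =>
    rw [hangPoly, hangPoly, cellComponents_image f ha,
      finprod_mem_image (hinj.image_injective.injOn)]
    exact finprod_mem_congr rfl fun K _ => by rw [hangCore_image f hf, ih]

theorem hasse_adj_add_iff (v a b : ℕ × ℕ) : (SimpleGraph.hasse (ℕ × ℕ)).Adj (a + v) (b + v) ↔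
    (SimpleGraph.hasse (ℕ × ℕ)).Adj a b := by
  simp only [hasse_prod_nat_adj_iff, Prod.fst_add, Prod.snd_add]
  omega

theorem hasse_adj_swap_iff (a b : ℕ × ℕ) : (SimpleGraph.hasse (ℕ × ℕ)).Adj a.swap b.swap ↔
    (SimpleGraph.hasse (ℕ × ℕ)).Adj a b := by
  simp only [hasse_prod_nat_adj_iff, Prod.fst_swap, Prod.snd_swap]
  omega

/-- A function of sets of cells is unchanged under a translation and an optional transposition, as
soon as it is unchanged under the injections which respect adjacency and compare antidiagonals. -/
theorem IsTranslate.congr_transposeIf {α : Type*} (F : Set (ℕ × ℕ) → α)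
    (hF : ∀ (f : ℕ × ℕ → ℕ × ℕ), f.Injective →
      (∀ p q, (f q).1 + (f q).2 < (f p).1 + (f p).2 ↔ q.1 + q.2 < p.1 + p.2) →
      (∀ a b, (SimpleGraph.hasse (ℕ × ℕ)).Adj (f a) (f b) ↔
        (SimpleGraph.hasse (ℕ × ℕ)).Adj a b) → ∀ X, F (f '' X) = F X)
    {A B : Set (ℕ × ℕ)} {t : Bool} (h : IsTranslate A (transposeIf t B)) : F A = F B := by
  obtain ⟨v, w, h⟩ := h
  have hadd : ∀ (v : ℕ × ℕ) X, F ((fun p => p + v) '' X) = F X := fun v X =>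
    hF _ (add_left_injective v) (fun p q => by simp only [Prod.fst_add, Prod.snd_add]; omega)
      (hasse_adj_add_iff v) X
  rw [← hadd v A, h, hadd]
  cases t
  · simp [transposeIf]
  · rw [transposeIf, if_pos rfl]
    exact hF _ Prod.swap_injective
      (fun p q => by simp only [Prod.fst_swap, Prod.snd_swap]; omega) hasse_adj_swap_iff B

/-! ### Comparison of the forest polynomial with the hanging polynomial -/

theorem wordMem_ge {u : List Bool} {i j : ℕ} {p : ℕ × ℕ} (h : wordMem u i j p) : j ≤ p.2 := by
  induction u generalizing i j with
  | nil => simp [wordMem] at h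
  | cons b u ih =>
    cases b
    · exact ih h
    · rcases h with h | h
      · omega
      · have := ih h; omega

theorem wordMem_fst_lt {u : List Bool} {i j : ℕ} {p : ℕ × ℕ} (h : wordMem u i j p) : p.1 < i := by
  induction u generalizing i j with
  | nil => simp [wordMem] at h
  | cons b u ih =>
    cases b
    · have := ih h; omega
    · rcases h with h | h
      · omega
      · exact ih h

theorem wordMem_mono {u : List Bool} {i j r r' c : ℕ} (h : wordMem u i j (r, c)) (hr : r' ≤ r) :
    wordMem u i j (r', c) := by
  induction u generalizing i j with
  | nil => simp [wordMem] at h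
  | cons b u ih =>
    cases b
    · exact ih h
    · rcases h with h | h
      · exact Or.inl ⟨h.1, hr.trans_lt h.2⟩
      · exact Or.inr (ih h)

namespace PlaneForest

theorem wordMem_word_of_lt (t : PlaneForest) {i j r c : ℕ} (hj : j ≤ c) (hc : c < j + t.size)
    (hr : r + c < i + j) (hi : t.size ≤ i) : wordMem t.word i j (r, c) := by
  induction t generalizing i j with
  | nil => simp [size] at hc; omega
  | node l s hl hs =>
    rw [wordMem_node]
    simp only [size] at hc hi
    by_cases h : c = j
    · left; exact ⟨h, by simp only; omega⟩
    · right
      by_cases h' : c < j + 1 + l.size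
      · exact Or.inl (hl (by omega) h' (by omega) (by omega))
      · exact Or.inr (hs (by omega) (by omega) (by omega) (by omega))

/-- The cells of the shape of a forest from the antidiagonal `i + j + e` on, rows and columns being
counted from one. -/
def region (t : PlaneForest) (i j e : ℕ) : Set (ℕ × ℕ) :=
  {p | wordMem t.word i j p ∧ i + j + e ≤ p.1 + p.2 + 1}

theorem region_finite (t : PlaneForest) (i j e : ℕ) : (t.region i j e).Finite := by
  refine Set.Finite.subset ((Set.finite_lt_nat i).prod (Set.finite_lt_nat (j + t.size))) ?_
  rintro p ⟨h, -⟩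
  have := wordMem_lt h
  rw [count_word] at this
  exact ⟨wordMem_fst_lt h, this⟩

/-- The cells of the first tree of `node l r` which belong to its region. -/
def treeRegion (l : PlaneForest) (i j : ℕ) : Set (ℕ × ℕ) :=
  (node l nil).region i j 0

theorem treeRegion_finite (l : PlaneForest) (i j : ℕ) : (l.treeRegion i j).Finite :=
  region_finite _ _ _ _

theorem region_fst_ge {t : PlaneForest} {i j e : ℕ} {p : ℕ × ℕ} (h : p ∈ t.region i j e) :
    i < p.1 + t.size + 1 := by
  have h' := wordMem_lt h.1
  rw [count_word] at h'
  have := h.2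
  omega

theorem region_node (l r : PlaneForest) (i j : ℕ) (h : (node l r).size ≤ i) :
    (node l r).region i j 0 =
      l.treeRegion i j ∪ r.region (i - (l.size + 1)) (j + (l.size + 1)) 0 := by
  simp only [size] at h
  ext p
  simp only [region, treeRegion, Set.mem_union, Set.mem_ofPred_eq, wordMem_node,
    show i - (l.size + 1) + (j + (l.size + 1)) = i + j by omega]
  simp only [word, wordMem, or_false]
  tauto

theorem region_one_node (l r : PlaneForest) (i j : ℕ) (h : (node l r).size ≤ i) :
    (node l r).region i j 1 =
      l.region i (j + 1) 0 ∪ r.region (i - (l.size + 1)) (j + (l.size + 1)) 1 := by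
  simp only [size] at h
  ext p
  simp only [region, Set.mem_union, Set.mem_ofPred_eq, wordMem_node,
    show i - (l.size + 1) + (j + (l.size + 1)) = i + j by omega, add_zero]
  constructor
  · rintro ⟨h | h | h, h'⟩
    · omega
    · exact Or.inl ⟨h, by omega⟩
    · exact Or.inr ⟨h, by omega⟩
  · rintro (⟨h, h'⟩ | ⟨h, h'⟩)
    · exact ⟨Or.inr (Or.inl h), by omega⟩
    · exact ⟨Or.inr (Or.inr h), by omega⟩

theorem region_lt_region {l r : PlaneForest} {i j e : ℕ} {p q : ℕ × ℕ}
    (hp : p ∈ l.treeRegion i j) (hq : q ∈ r.region (i - (l.size + 1)) (j + (l.size + 1)) e) :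
    q.1 < p.1 ∧ p.2 < q.2 := by
  have h₁ := wordMem_lt hp.1
  have h₂ := region_fst_ge hp
  have h₃ := wordMem_ge hq.1
  have h₄ := wordMem_fst_lt hq.1
  simp only [count_word, size] at h₁ h₂
  omega

theorem region_subset_treeRegion (l : PlaneForest) (i j : ℕ) :
    l.region i (j + 1) 0 ⊆ l.treeRegion i j := by
  rintro p ⟨h, h'⟩
  exact ⟨(wordMem_node _ _ _ _ _).2 (Or.inr (Or.inl h)), by omega⟩

theorem mem_treeRegion {l : PlaneForest} {i j : ℕ} {p : ℕ × ℕ} : p ∈ l.treeRegion i j ↔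
    ((p.2 = j ∧ p.1 < i) ∨ wordMem l.word i (j + 1) p) ∧ i + j ≤ p.1 + p.2 + 1 := by
  rw [treeRegion, region, Set.mem_ofPred_eq, wordMem_node]
  simp [word, wordMem]

theorem hangCore_treeRegion (l : PlaneForest) (i j : ℕ) (hi : 0 < i) :
    hangCore (l.treeRegion i j) = l.region i (j + 1) 0 := by
  ext p
  constructor
  · rintro ⟨hp, q, hq, hpq⟩
    rw [mem_treeRegion] at hp hq
    refine ⟨?_, by omega⟩
    rcases hp.1 with h | h
    · omega
    · exact h
  · rintro hp
    -- The foot of column j is the only cell of that column in the region, and it lies on the lowest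
    -- antidiagonal.
    refine ⟨region_subset_treeRegion l i j hp, (i - 1, j), ?_, ?_⟩
    · rw [mem_treeRegion]
      exact ⟨Or.inl ⟨rfl, by simp only; omega⟩, by simp only; omega⟩
    · have := hp.2
      simp only
      omega

/-- Every column after the first belongs to the child forest, whose shape contains a staircase
reaching one antidiagonal further; there it touches its left neighbour. -/
theorem cellReach_treeRegion (l : PlaneForest) (i j : ℕ) (hi : l.size < i) :
    ∀ p ∈ l.treeRegion i j, CellReach (l.treeRegion i j) (i + j - 1 - j, j) p := by
  have hlt : ∀ r c, (r, c) ∈ l.treeRegion i j → c < j + (l.size + 1) := by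
    intro r c h
    have := wordMem_lt h.1
    simpa [count_word, size] using this
  apply cellReach_of_columns
  · intro r c h
    have h₁ := h.2
    have h₂ := hlt r c h
    have h₃ := wordMem_ge h.1
    simp only at h₁ h₃
    omega
  · rintro r r' c ⟨h, -⟩ hr hd
    exact ⟨wordMem_mono h hr, by simp only; omega⟩
  · intro r c h hc
    have h₂ := hlt r c h
    simp only [mem_treeRegion]
    refine ⟨⟨Or.inr (l.wordMem_word_of_lt (by omega) (by omega) (by omega) (by omega)), by omega⟩,
      ?_, by omega⟩
    by_cases hcj : c - 1 = j
    · exact Or.inl ⟨hcj, by omega⟩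
    · exact Or.inr (l.wordMem_word_of_lt (by omega) (by omega) (by omega) (by omega))

/-- The first tree is connected and lies strictly below and to the left of its siblings, so the
components are the trees; the core of a tree is the region of its child forest. -/
theorem hangPoly_region (t : PlaneForest) (f i j : ℕ) (hf : t.size ≤ f) (hi : t.size ≤ i) :
    hangPoly f (t.region i j 0) = t.poly := by
  induction t generalizing f i j with
  | nil =>
    rw [show nil.region i j 0 = ∅ by simp [region, word, wordMem], hangPoly_empty, poly]
  | node l r hl hr =>
    have hs : (node l r).size = l.size + 1 + r.size := rfl
    obtain ⟨f, rfl⟩ : ∃ g, f = g + 1 := ⟨f - 1, by omega⟩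
    rw [region_node l r i j hi, hangPoly_union _ (treeRegion_finite _ _ _) (region_finite _ _ _ _)
      fun p hp q hq => region_lt_region hp hq, hr _ _ _ (by omega) (by omega),
      hangPoly_of_reach f _ (cellReach_treeRegion l i j (by omega)),
      hangCore_treeRegion l i j (by omega), hl _ _ _ (by omega) (by omega), poly]
    rw [mem_treeRegion]
    exact ⟨Or.inl ⟨rfl, by simp only; omega⟩, by simp only; omega⟩

/-- The constant term of `nestPoly f` is the value of f at 1. This removes the outer `nestPoly` of
each tree, as starting one antidiagonal further removes its root. -/
theorem eval_zero_poly (t : PlaneForest) (f i j : ℕ) (hf : t.size ≤ f) (hi : t.size ≤ i) :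
    t.poly.eval 0 = (hangPoly f (t.region i j 1)).eval 1 := by
  induction t generalizing i j with
  | nil =>
    rw [show nil.region i j 1 = ∅ by simp [region, word, wordMem], hangPoly_empty, poly]
    simp
  | node l r hl hr =>
    have hs : (node l r).size = l.size + 1 + r.size := rfl
    rw [region_one_node l r i j hi, hangPoly_union _ (region_finite _ _ _ _) (region_finite _ _ _ _)
      fun p hp q hq => region_lt_region (region_subset_treeRegion l i j hp) hq, poly,
      Polynomial.eval_mul, Polynomial.eval_mul, eval_zero_nestPoly,
      hr (i - (l.size + 1)) (j + (l.size + 1)) (by omega) (by omega),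
      hangPoly_region l f _ _ (by omega) (by omega)]

end PlaneForest

/-! ### Antidiagonals of a diagram and connectivity below a staircase -/

/-- The cells of `Y` outside the staircase `St_k`. -/
def YoungDiagram.hanging (Y : YoungDiagram) (n k : ℕ) : Set (ℕ × ℕ) :=
  (Y.cells : Set (ℕ × ℕ)) \ staircase n k

theorem YoungDiagram.HasSize.mem_hanging {Y : YoungDiagram} {n : ℕ} (hY : Y.HasSize n) (k : ℕ)
    (p : ℕ × ℕ) : p ∈ Y.hanging n k ↔ p ∈ Y ∧ n + k ≤ p.1 + p.2 + 1 := by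
  simp only [YoungDiagram.hanging, staircase, Set.mem_sdiff, Finset.mem_coe, YoungDiagram.mem_cells,
    Set.mem_ofPred_eq]
  constructor
  · rintro ⟨h, h'⟩
    have := hY.fst_lt h
    have := hY.snd_lt h
    exact ⟨h, by omega⟩
  · rintro ⟨h, h'⟩
    exact ⟨h, by omega⟩

theorem YoungDiagram.HasSize.numAvoiding_eq {Y : YoungDiagram} {n : ℕ} (hY : Y.HasSize n) (f : ℕ)
    (hf : n ≤ f) :
    Y.numAvoiding pattern213 = (hangPoly f (Y.hanging n 1)).eval 1 := by
  obtain ⟨t, ht, hm, h⟩ := hY.exists_forest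
  rw [h, t.eval_zero_poly f n 0 (by omega) (by omega)]
  congr 2
  ext p
  rw [hY.mem_hanging, hm]
  rfl

namespace YoungDiagram

/-- The columns of the cells of `Y` on the antidiagonal `d` of the `n × n` square. -/
noncomputable def diagCols (Y : YoungDiagram) (n d : ℕ) : Finset ℕ :=
  (Finset.range n).filter fun x => (d - x, x) ∈ Y

variable {Y : YoungDiagram} {n k : ℕ}

theorem HasSize.mem_diagCols (hY : Y.HasSize n) {d x : ℕ} :
    x ∈ Y.diagCols n d ↔ (d - x, x) ∈ Y := by
  rw [diagCols, Finset.mem_filter, Finset.mem_range, and_iff_right_iff_imp]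
  exact hY.snd_lt

theorem HasSize.mem_of_mem_component (hY : Y.HasSize n) {K : Set (ℕ × ℕ)}
    (hK : K ∈ Y.hangingComponents n k) {p : ℕ × ℕ} (hp : p ∈ K) :
    p ∈ Y ∧ n + k ≤ p.1 + p.2 + 1 :=
  (hY.mem_hanging k p).1 (subset_of_mem_cellComponents hK hp)

/-- A component of the complement of a staircase is closed under going up or left as long as one
stays out of the staircase. -/
theorem HasSize.component_closed (hY : Y.HasSize n) {K : Set (ℕ × ℕ)}
    (hK : K ∈ Y.hangingComponents n k) {r c r' c' : ℕ} (hp : (r, c) ∈ K) (hr : r' ≤ r)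
    (hc : c' ≤ c) (hd : n + k ≤ r' + c' + 1) : (r', c') ∈ K := by
  have up : ∀ m r c, (r + m, c) ∈ K → n + k ≤ r + c + 1 → (r, c) ∈ K := by
    intro m
    induction m with
    | zero => exact fun r c h _ => h
    | succ m ih =>
      intro r c h hd
      refine mem_of_hasse_adj hK (ih (r + 1) c (by rwa [add_right_comm]) (by omega)) ?_ ?_
      · exact (hY.mem_hanging k _).2
          ⟨Y.up_left_mem (by omega) le_rfl (hY.mem_of_mem_component hK h).1, hd⟩
      · rw [hasse_prod_nat_adj_iff]; exact Or.inr ⟨rfl, Or.inr rfl⟩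
  have left : ∀ m r c, (r, c + m) ∈ K → n + k ≤ r + c + 1 → (r, c) ∈ K := by
    intro m
    induction m with
    | zero => exact fun r c h _ => h
    | succ m ih =>
      intro r c h hd
      refine mem_of_hasse_adj hK (ih r (c + 1) (by rwa [add_right_comm]) (by omega)) ?_ ?_
      · exact (hY.mem_hanging k _).2
          ⟨Y.up_left_mem le_rfl (by omega) (hY.mem_of_mem_component hK h).1, hd⟩
      · rw [hasse_prod_nat_adj_iff]; exact Or.inl ⟨rfl, Or.inr rfl⟩
  obtain ⟨m, rfl⟩ := Nat.exists_eq_add_of_le hr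
  obtain ⟨m', rfl⟩ := Nat.exists_eq_add_of_le hc
  exact left m' _ _ (up m _ _ hp (by omega)) hd

/-- Between two cells of a component on its lowest antidiagonal, the component contains all cells
of this antidiagonal and of the next one. -/
theorem HasSize.component_between (hY : Y.HasSize n) (hk : 1 ≤ k) {K : Set (ℕ × ℕ)}
    (hK : K ∈ Y.hangingComponents n k) {x y z : ℕ} (hx : (n + k - 1 - x, x) ∈ K)
    (hy : (n + k - 1 - y, y) ∈ K) (hxz : x < z) (hzy : z ≤ y) :
    (n + k - z, z) ∈ K ∧ (n + k - 1 - z, z) ∈ K := by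
  have hyn := hY.snd_lt (hY.mem_of_mem_component hK hy).1
  simp only at hyn
  have inY : ∀ z, x < z → z ≤ y → (n + k - z, z) ∈ Y := by
    intro z hxz hzy
    by_contra hz
    -- Any step from column z - 1 to column z outside the staircase would end at or below the
    -- missing cell. So no path crosses into column z, contrary to y ≥ z.
    have hsub := subset_of_closed hK (A := {p ∈ Y.hanging n k | p.2 < z}) hx
      ⟨subset_of_mem_cellComponents hK hx, hxz⟩ (by
        rintro ⟨r, c⟩ ⟨ha, hac⟩ ⟨r', c'⟩ hb hab
        refine ⟨hb, ?_⟩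
        by_contra! hbc
        replace hb := (hY.mem_hanging k _).1 hb
        rw [hY.mem_hanging] at ha
        rw [hasse_prod_nat_adj_iff] at hab
        simp only at *
        refine hz (Y.up_left_mem (?_ : _ ≤ r') hbc hb.1)
        omega)
    have := (hsub hy).2
    simp only at this
    omega
  have main : ∀ m, x + m ≤ y → (n + k - 1 - (x + m), x + m) ∈ K ∧
      (1 ≤ m → (n + k - (x + m), x + m) ∈ K) := by
    intro m
    induction m with
    | zero => exact fun _ => ⟨hx, by omega⟩
    | succ m ih =>
      intro hm
      have h := (ih (by omega)).1
      have h' : (n + k - (x + (m + 1)), x + (m + 1)) ∈ K := by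
        refine mem_of_hasse_adj hK h ?_ ?_
        · exact (hY.mem_hanging k _).2 ⟨inY _ (by omega) hm, by simp only; omega⟩
        · rw [hasse_prod_nat_adj_iff]
          simp only
          omega
      refine ⟨?_, fun _ => h'⟩
      exact hY.component_closed hK h' (by omega) le_rfl (by omega)
  obtain ⟨m, rfl⟩ := Nat.exists_eq_add_of_le hxz.le
  exact ⟨(main m hzy).2 (by omega), (main m hzy).1⟩

theorem HasSize.diag_mem_hanging (hY : Y.HasSize n) {x : ℕ}
    (hx : x ∈ Y.diagCols n (n + k - 1)) : (n + k - 1 - x, x) ∈ Y.hanging n k := by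
  rw [hY.mem_diagCols] at hx
  have := hY.snd_lt hx
  exact (hY.mem_hanging _ _).2 ⟨hx, by simp only at *; omega⟩

theorem HasSize.mem_diagCols_of_mem_hanging (hY : Y.HasSize n) {p : ℕ × ℕ}
    (hp : p ∈ Y.hanging n k) : p.2 ∈ Y.diagCols n (n + k - 1) := by
  rw [hY.mem_hanging] at hp
  rw [hY.mem_diagCols]
  exact Y.up_left_mem (by omega) le_rfl hp.1

theorem HasSize.component_eq_of_subsingleton (hY : Y.HasSize n)
    (h : (Y.hangingComponents n k).Subsingleton) {x y : ℕ}
    (hx : x ∈ Y.diagCols n (n + k - 1)) (hy : y ∈ Y.diagCols n (n + k - 1)) :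
    ∃ K ∈ Y.hangingComponents n k, (n + k - 1 - x, x) ∈ K ∧ (n + k - 1 - y, y) ∈ K := by
  obtain ⟨K, hK, hxK⟩ := exists_mem_cellComponents (hY.diag_mem_hanging hx)
  obtain ⟨K', hK', hyK'⟩ := exists_mem_cellComponents (hY.diag_mem_hanging hy)
  exact ⟨K, hK, hxK, h hK' hK ▸ hyK'⟩

/-- A cell in column x of the next antidiagonal lies below one of the current antidiagonal and to
the right of another. So when the current one is nonempty, the next has at least one column fewer,
the leftmost being lost. Equality means that each other column is linked to its left neighbour,
which is connectedness. -/
theorem HasSize.subsingleton_iff (hY : Y.HasSize n) (hk : 1 ≤ k) :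
    (Y.hangingComponents n k).Subsingleton ↔
      (Y.diagCols n (n + k - 1)).card ≤ (Y.diagCols n (n + k)).card + 1 := by
  rcases (Y.diagCols n (n + k - 1)).eq_empty_or_nonempty with he | hne
  · have : Y.hanging n k = ∅ := by
      ext p
      simp only [Set.mem_empty_iff_false, iff_false]
      intro hp
      have := hY.mem_diagCols_of_mem_hanging hp
      simp [he] at this
    simp only [he, Finset.card_empty, zero_le, iff_true]
    change (cellComponents (Y.hanging n k)).Subsingleton
    rw [this, cellComponents_empty]
    exact Set.subsingleton_empty
  · set c₀ := (Y.diagCols n (n + k - 1)).min' hne with hc₀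
    have hc₀m : c₀ ∈ Y.diagCols n (n + k - 1) := Finset.min'_mem _ _
    constructor
    · intro h
      have hsub : (Y.diagCols n (n + k - 1)).erase c₀ ⊆ Y.diagCols n (n + k) := by
        intro x hx
        obtain ⟨hxc, hx⟩ := Finset.mem_erase.1 hx
        have hlt : c₀ < x := lt_of_le_of_ne (Finset.min'_le _ _ hx) (Ne.symm hxc)
        obtain ⟨K, hK, h₁, h₂⟩ := hY.component_eq_of_subsingleton h hc₀m hx
        rw [hY.mem_diagCols]
        exact (hY.mem_of_mem_component hK (hY.component_between hk hK h₁ h₂ hlt le_rfl).1).1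
      have := Finset.card_le_card hsub
      rw [Finset.card_erase_of_mem hc₀m] at this
      omega
    · intro h
      have pred : ∀ x ∈ Y.diagCols n (n + k), 1 ≤ x ∧ (n + k - x, x - 1) ∈ Y := by
        intro x hx
        rw [hY.mem_diagCols] at hx
        have := hY.fst_lt hx
        exact ⟨by simp only at this; omega, Y.up_left_mem le_rfl (by omega) hx⟩
      have hsub : Y.diagCols n (n + k) ⊆ (Y.diagCols n (n + k - 1)).erase c₀ := by
        intro x hx
        obtain ⟨h1, h2⟩ := pred x hx
        have : x - 1 ∈ Y.diagCols n (n + k - 1) := by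
          rw [hY.mem_diagCols]
          exact Y.up_left_mem (by omega) le_rfl h2
        have := Finset.min'_le _ _ this
        refine Finset.mem_erase.2 ⟨by omega, ?_⟩
        rw [hY.mem_diagCols] at hx ⊢
        exact Y.up_left_mem (by omega) le_rfl hx
      have heq := Finset.eq_of_subset_of_card_le hsub (by
        rw [Finset.card_erase_of_mem hc₀m]; omega)
      change (cellComponents (Y.hanging n k)).Subsingleton
      rw [cellComponents_of_reach (hY.diag_mem_hanging hc₀m)]
      · exact Set.subsingleton_singleton
      · apply cellReach_of_columns
        · intro r c hp
          have h1 := Finset.min'_le _ _ (hY.mem_diagCols_of_mem_hanging hp)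
          rw [hY.mem_hanging] at hp
          have h2 := hY.snd_lt hp.1
          simp only at *
          omega
        · intro r r' c hp hr hd
          rw [hY.mem_hanging] at hp ⊢
          exact ⟨Y.up_left_mem hr le_rfl hp.1, by simp only; omega⟩
        · intro r c hp hc
          have h1 := hY.mem_diagCols_of_mem_hanging hp
          have h2 : c ∈ Y.diagCols n (n + k) := by
            rw [heq]
            exact Finset.mem_erase.2 ⟨by omega, h1⟩
          have h3 := pred c h2
          rw [hY.mem_diagCols] at h2
          have h4 := hY.snd_lt h2
          simp only at h4
          rw [hY.mem_hanging, hY.mem_hanging, show n + k - 1 + 1 - c = n + k - c by omega]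
          exact ⟨⟨h2, by simp only; omega⟩, h3.2, by simp only; omega⟩

/-- When the complement of the previous staircase is connected, the cells of the next antidiagonal
are consecutive. -/
theorem HasSize.diagCols_between (hY : Y.HasSize n) (hk : 1 ≤ k)
    (h : (Y.hangingComponents n k).Subsingleton) {x y z : ℕ}
    (hx : x ∈ Y.diagCols n (n + k)) (hy : y ∈ Y.diagCols n (n + k)) (hxz : x ≤ z) (hzy : z ≤ y) :
    z ∈ Y.diagCols n (n + k) := by
  rcases hxz.eq_or_lt with rfl | hxz
  · exact hx
  have prev : ∀ x ∈ Y.diagCols n (n + k), x ∈ Y.diagCols n (n + k - 1) := by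
    intro x hx
    rw [hY.mem_diagCols] at hx ⊢
    exact Y.up_left_mem (by omega) le_rfl hx
  obtain ⟨K, hK, h₁, h₂⟩ := hY.component_eq_of_subsingleton h (prev x hx) (prev y hy)
  rw [hY.mem_diagCols]
  exact (hY.mem_of_mem_component hK (hY.component_between hk hK h₁ h₂ hxz hzy).1).1

/-! ### Invariance under rearrangement -/

section ComponentList

variable {l : ℕ} {S : Fin l → Set (ℕ × ℕ)}

theorem IsComponentList.mem (hS : Y.IsComponentList n k S) (j : Fin l) :
    S j ∈ Y.hangingComponents n k := hS.1 ▸ Set.mem_range_self j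

theorem IsComponentList.exists_mem (hS : Y.IsComponentList n k S) {p : ℕ × ℕ}
    (hp : p ∈ Y.hanging n k) : ∃ j, p ∈ S j := by
  obtain ⟨K, hK, hpK⟩ := exists_mem_cellComponents hp
  obtain ⟨j, rfl⟩ : K ∈ Set.range S := by rw [hS.1]; exact hK
  exact ⟨j, hpK⟩

theorem IsComponentList.eq_of_mem (hS : Y.IsComponentList n k S) {a b : Fin l} {p : ℕ × ℕ}
    (ha : p ∈ S a) (hb : p ∈ S b) : a = b := by
  rcases lt_trichotomy a b with h | h | h
  · exact absurd (hS.2 a b h p ha p hb).1 (lt_irrefl _)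
  · exact h
  · exact absurd (hS.2 b a h p hb p ha).1 (lt_irrefl _)

theorem IsComponentList.injective (hS : Y.IsComponentList n k S) : S.Injective := by
  intro a b h
  obtain ⟨p, hp⟩ := nonempty_of_mem_cellComponents (hS.mem a)
  exact hS.eq_of_mem hp (h ▸ hp)

theorem HasSize.component_diag (hY : Y.HasSize n) {K : Set (ℕ × ℕ)} (hk : 1 ≤ k)
    (hK : K ∈ Y.hangingComponents n k) {p : ℕ × ℕ} (hp : p ∈ K) :
    (n + k - 1 - p.2, p.2) ∈ K := by
  have := hY.mem_of_mem_component hK hp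
  have := hY.snd_lt this.1
  exact hY.component_closed hK hp (by omega) le_rfl (by omega)

/-- The antidiagonal just outside the staircase is the disjoint union of the lowest antidiagonals of
the components, so its size is unchanged by moving or reflecting them. -/
theorem HasSize.card_diagCols (hY : Y.HasSize n) (hk : 1 ≤ k) (hS : Y.IsComponentList n k S) :
    (Y.diagCols n (n + k - 1)).card = ∑ j, (S j \ hangCore (S j)).ncard := by
  have h : Y.diagCols n (n + k - 1) = Finset.univ.biUnion fun j =>
      (Y.diagCols n (n + k - 1)).filter fun x => (n + k - 1 - x, x) ∈ S j := by
    ext x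
    simp only [Finset.mem_biUnion, Finset.mem_univ, true_and, Finset.mem_filter]
    refine ⟨fun hx => ?_, fun ⟨_, hx, _⟩ => hx⟩
    obtain ⟨j, hj⟩ := hS.exists_mem (hY.diag_mem_hanging hx)
    exact ⟨j, hx, hj⟩
  rw [h, Finset.card_biUnion]
  · refine Finset.sum_congr rfl fun j _ => ?_
    have : S j \ hangCore (S j) = (fun x => (n + k - 1 - x, x)) ''
        (((Y.diagCols n (n + k - 1)).filter fun x => (n + k - 1 - x, x) ∈ S j : Finset ℕ) :
          Set ℕ) := by
      ext p
      simp only [Set.mem_image, Finset.mem_coe, Finset.mem_filter]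
      constructor
      · rintro ⟨hp, hp'⟩
        have hd := hY.component_diag hk (hS.mem j) hp
        have h₁ := hY.mem_of_mem_component (hS.mem j) hp
        have h₂ := hY.snd_lt h₁.1
        have h₃ : ¬ ((n + k - 1 - p.2) + p.2 < p.1 + p.2) := fun h => hp' ⟨hp, _, hd, h⟩
        refine ⟨p.2, ⟨?_, hd⟩, Prod.ext (by simp only; omega) rfl⟩
        exact hY.mem_diagCols.2 (hY.mem_of_mem_component (hS.mem j) hd).1
      · rintro ⟨x, ⟨-, hx⟩, rfl⟩
        refine ⟨hx, ?_⟩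
        rintro ⟨-, q, hq, h⟩
        have h₁ := hY.mem_of_mem_component (hS.mem j) hq
        have h₂ := hY.snd_lt (hY.mem_of_mem_component (hS.mem j) hx).1
        simp only at h h₂
        omega
    rw [this, Set.ncard_image_of_injective _ fun x y h => (Prod.ext_iff.1 h).2,
      Set.ncard_coe_finset]
  · intro a _ b _ hab
    rw [Function.onFun, Finset.disjoint_left]
    intro x hxa hxb
    exact hab (hS.eq_of_mem (Finset.mem_filter.1 hxa).2 (Finset.mem_filter.1 hxb).2)

theorem IsCritical.subsingleton {k' : ℕ} (hc : Y.IsCritical n k) (h : 1 ≤ k') (hk : k' < k) :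
    (Y.hangingComponents n k').Subsingleton := by
  rw [← Set.not_nontrivial_iff]
  exact fun hn => (hc.2 ⟨h, hn⟩).not_gt hk

/-- By `subsingleton_iff`, connectedness for k' < k depends on the sizes of two consecutive
antidiagonals. These lie in the common part of `Y` and `Y'`, except that for k' = k - 1 the second
one is the first outside the staircase, where the sizes agree by `card_diagCols`. -/
theorem IsCritical.of_isRearrangement {Y' : YoungDiagram} (hY : Y.HasSize n)
    (hc : Y.IsCritical n k) (hS : Y.IsComponentList n k S) {τ : Equiv.Perm (Fin l)}
    {t : Fin l → Bool} (h : Y'.IsRearrangement Y n k S τ t) : Y'.IsCritical n k := by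
  obtain ⟨hY', hcap, S', hS', htr⟩ := h
  have hk := hc.1.1
  have hcard : (Y'.diagCols n (n + k - 1)).card = (Y.diagCols n (n + k - 1)).card := by
    rw [hY'.card_diagCols hk hS', hY.card_diagCols hk hS,
      ← Equiv.sum_comp τ fun j => (S j \ hangCore (S j)).ncard]
    refine Finset.sum_congr rfl fun j _ => ?_
    refine (htr j).congr_transposeIf (fun K => (K \ hangCore K).ncard) ?_
    intro f hinj hf _ X
    rw [hangCore_image f hf, ← Set.image_sdiff hinj, Set.ncard_image_of_injective _ hinj]
  have heq : ∀ d, d + 1 < n + k → Y'.diagCols n d = Y.diagCols n d := by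
    have main : ∀ Z Z' : YoungDiagram, Z.HasSize n → Z'.HasSize n →
        (Z.cells : Set (ℕ × ℕ)) ∩ staircase n k ⊆ (Z'.cells : Set (ℕ × ℕ)) ∩ staircase n k →
        ∀ d, d + 1 < n + k → Z.diagCols n d ⊆ Z'.diagCols n d := by
      intro Z Z' hZ hZ' hsub d hd x hx
      rw [hZ.mem_diagCols] at hx
      rw [hZ'.mem_diagCols]
      have h₁ := hZ.fst_lt hx
      have h₂ := hZ.snd_lt hx
      simp only at h₁ h₂
      exact (hsub ⟨hx, h₁, h₂, by simp only; omega⟩).1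
    exact fun d hd => (main _ _ hY' hY hcap.le d hd).antisymm (main _ _ hY hY' hcap.ge d hd)
  refine ⟨⟨hk, ?_⟩, ?_⟩
  · obtain ⟨A, hA, B, hB, hAB⟩ := hc.1.2
    rw [← hS.1] at hA hB
    obtain ⟨a, rfl⟩ := hA
    obtain ⟨b, rfl⟩ := hB
    exact ⟨S' a, hS'.mem a, S' b, hS'.mem b, fun h => hAB (congrArg S (hS'.injective h))⟩
  · rintro k' ⟨hk', hn⟩
    by_contra! hlt
    rw [← Set.not_subsingleton_iff] at hn
    apply hn
    have := hc.subsingleton hk' hlt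
    rw [hY.subsingleton_iff hk'] at this
    rw [hY'.subsingleton_iff hk', heq _ (by omega)]
    rcases (show k' + 1 ≤ k from hlt).eq_or_lt with rfl | hlt'
    · rw [show n + k' = n + (k' + 1) - 1 by omega, hcard]
      exact this
    · rwa [heq _ (by omega)]

/-- A connected complement is its own only component, and its core is the next complement. An empty
one would instead give the empty product 1. -/
theorem HasSize.hangPoly_hanging_succ (hY : Y.HasSize n) (hk : 1 ≤ k) (f : ℕ)
    (h : (Y.hangingComponents n k).Subsingleton) (hne : (Y.hanging n k).Nonempty) :
    hangPoly (f + 1) (Y.hanging n k) = nestPoly (hangPoly f (Y.hanging n (k + 1))) := by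
  obtain ⟨p, hp⟩ := hne
  obtain ⟨K, hK, hpK⟩ := exists_mem_cellComponents hp
  have hcore : hangCore (Y.hanging n k) = Y.hanging n (k + 1) := by
    ext q
    constructor
    · rintro ⟨hq, q', hq', hlt⟩
      rw [hY.mem_hanging] at *
      exact ⟨hq.1, by omega⟩
    · intro hq
      rw [hY.mem_hanging] at hq
      have hq' := (hY.mem_hanging k q).2 ⟨hq.1, by omega⟩
      have hlt := hY.snd_lt hq.1
      refine ⟨hq', _, hY.diag_mem_hanging (hY.mem_diagCols_of_mem_hanging hq'), ?_⟩
      simp only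
      omega
  rw [hangPoly_of_reach f hp, hcore]
  intro q hq
  obtain ⟨K', hK', hqK'⟩ := exists_mem_cellComponents hq
  rw [h hK' hK, eq_of_mem_cellComponents hK hpK] at hqK'
  exact hqK'

/-- The number of avoiders in terms of the critical staircase and the components below it. -/
theorem HasSize.numAvoiding_eq_of_isCritical (hY : Y.HasSize n) (hc : Y.IsCritical n k)
    (hS : Y.IsComponentList n k S) :
    Y.numAvoiding pattern213 = Polynomial.eval 1
      (nestPoly^[k - 1] (∏ j, nestPoly (hangPoly n (hangCore (S j))))) := by
  have hne : (Y.hanging n k).Nonempty := by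
    obtain ⟨A, hA, -⟩ := hc.1.2
    obtain ⟨p, hp⟩ := nonempty_of_mem_cellComponents hA
    exact ⟨p, subset_of_mem_cellComponents hA hp⟩
  have hk := hc.1.1
  -- Descend from `St_k` towards `St_1`, one `nestPoly` per connected complement.
  have main : ∀ m, m < k → hangPoly (n + 1 + m) (Y.hanging n (k - m)) =
      nestPoly^[m] (hangPoly (n + 1) (Y.hanging n k)) := by
    intro m
    induction m with
    | zero => exact fun _ => rfl
    | succ m ih =>
      intro hm
      rw [Function.iterate_succ_apply', ← ih (by omega), ← add_assoc, hY.hangPoly_hanging_succ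
        (by omega) _ (hc.subsingleton (by omega) (by omega)),
        show k - (m + 1) + 1 = k - m by omega]
      refine hne.mono fun p hp => ?_
      rw [hY.mem_hanging] at hp ⊢
      exact ⟨hp.1, by omega⟩
  have hk1 := main (k - 1) (by omega)
  rw [show k - (k - 1) = 1 by omega] at hk1
  rw [hY.numAvoiding_eq (n + 1 + (k - 1)) (by omega), hk1, hangPoly]
  congr 2
  change ∏ᶠ K ∈ Y.hangingComponents n k, _ = _
  rw [← hS.1, finprod_mem_range hS.injective, finprod_eq_prod_of_fintype]

theorem numAvoiding_eq_of_isRearrangement {Y' : YoungDiagram} (hY : Y.HasSize n)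
    (hc : Y.IsCritical n k) (hS : Y.IsComponentList n k S) {τ : Equiv.Perm (Fin l)}
    {t : Fin l → Bool} (h : Y'.IsRearrangement Y n k S τ t) :
    Y'.numAvoiding pattern213 = Y.numAvoiding pattern213 := by
  have hc' := hc.of_isRearrangement hY hS h
  obtain ⟨hY', -, S', hS', htr⟩ := h
  rw [hY'.numAvoiding_eq_of_isCritical hc' hS', hY.numAvoiding_eq_of_isCritical hc hS,
    ← Equiv.prod_comp τ fun j => nestPoly (hangPoly n (hangCore (S j)))]
  congr 2
  refine Finset.prod_congr rfl fun j _ => ?_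
  refine (htr j).congr_transposeIf (fun K => nestPoly (hangPoly n (hangCore K))) ?_
  intro f hinj hf ha X
  rw [hangCore_image f hf, hangPoly_image n f hinj hf ha]

end ComponentList

end YoungDiagram

/-! ### Construction of a rearrangement -/

/-- The set of cells `K` hangs below the antidiagonal `d`, which it meets in the `m` columns from
the column `e` on, and it is connected. -/
structure HangsAt (d e m : ℕ) (K : Set (ℕ × ℕ)) : Prop where
  pos : 0 < m
  le : e + m ≤ d + 1
  bound : ∀ r c, (r, c) ∈ K → e ≤ c ∧ c < e + m ∧ d ≤ r + c ∧ r + e ≤ d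
  closed : ∀ r c r' c', (r, c) ∈ K → r' ≤ r → c' ≤ c → d ≤ r' + c' → (r', c') ∈ K
  diag : ∀ x, e ≤ x → x < e + m → (d - x, x) ∈ K
  next : ∀ x, e < x → x < e + m → (d + 1 - x, x) ∈ K

namespace HangsAt

variable {d e m : ℕ} {K : Set (ℕ × ℕ)}

/-- Reflection sends column x of the antidiagonal to column d - x, so the last column e + m - 1
becomes the first. -/
theorem swap (h : HangsAt d e m K) : HangsAt d (d + 1 - e - m) m (Prod.swap '' K) := by
  have hm : ∀ r c, (r, c) ∈ Prod.swap '' K ↔ (c, r) ∈ K := fun r c => by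
    simp
  have hle := h.le
  have hpos := h.pos
  refine ⟨h.pos, by omega, ?_, ?_, ?_, ?_⟩ <;> simp only [hm]
  · intro r c hp
    have := h.bound _ _ hp
    omega
  · exact fun r c r' c' hp hr hc hd => h.closed _ _ _ _ hp hc hr (by omega)
  · intro x h₁ h₂
    have := h.diag (d - x) (by omega) (by omega)
    rwa [Nat.sub_sub_self (by omega)] at this
  · intro x h₁ h₂
    have := h.next (d + 1 - x) (by omega) (by omega)
    rwa [Nat.sub_sub_self (by omega)] at this

theorem transposeIf (h : HangsAt d e m K) (t : Bool) :
    ∃ e', HangsAt d e' m (transposeIf t K) := by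
  cases t
  · exact ⟨e, by simpa [_root_.transposeIf] using h⟩
  · exact ⟨_, by simpa [_root_.transposeIf] using h.swap⟩

theorem exists_translate (h : HangsAt d e m K) {e' : ℕ} (he : e' + m ≤ d + 1) :
    ∃ K', HangsAt d e' m K' ∧ IsTranslate K' K := by
  have hle := h.le
  have hpos := h.pos
  -- The corners (a, e) and (a', e') of the two bounding boxes have equal coordinate sums, so the
  -- shift preserves antidiagonals.
  obtain ⟨a, ha⟩ := Nat.exists_eq_add_of_le h.le
  obtain ⟨a', ha'⟩ := Nat.exists_eq_add_of_le he
  have hm : ∀ r c, (r, c) ∈ {p : ℕ × ℕ | ∃ q ∈ K, p + (a, e) = q + (a', e')} ↔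
      ∃ r' c', (r', c') ∈ K ∧ r + a = r' + a' ∧ c + e = c' + e' := by
    intro r c
    simp only [Set.mem_ofPred_eq, Prod.exists, Prod.mk_add_mk, Prod.mk.injEq]
  refine ⟨{p | ∃ q ∈ K, p + (a, e) = q + (a', e')}, ⟨h.pos, he, ?_, ?_, ?_, ?_⟩,
    (a, e), (a', e'), ?_⟩
  · intro r c hp
    obtain ⟨r', c', hp, h₁, h₂⟩ := (hm _ _).1 hp
    have := h.bound _ _ hp
    omega
  · intro r c r' c' hp hr hc hd
    obtain ⟨s, t, hp, h₁, h₂⟩ := (hm _ _).1 hp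
    have := h.bound _ _ hp
    exact (hm _ _).2 ⟨r' + a - a', c' + e - e', h.closed _ _ _ _ hp (by omega) (by omega)
      (by omega), by omega, by omega⟩
  · intro x h₁ h₂
    exact (hm _ _).2 ⟨d - (x + e - e'), x + e - e', h.diag _ (by omega) (by omega),
      by omega, by omega⟩
  · intro x h₁ h₂
    exact (hm _ _).2 ⟨d + 1 - (x + e - e'), x + e - e', h.next _ (by omega) (by omega),
      by omega, by omega⟩
  · ext p
    constructor
    · rintro ⟨p, ⟨q, hq, hpq⟩, rfl⟩
      exact ⟨q, hq, hpq.symm⟩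
    · rintro ⟨⟨r, c⟩, hq, rfl⟩
      have := h.bound _ _ hq
      have heq : ((r + a' - a, c + e' - e) : ℕ × ℕ) + (a, e) = (r, c) + (a', e') := by
        simp only [Prod.mk_add_mk, Prod.mk.injEq]
        omega
      exact ⟨(r + a' - a, c + e' - e), ⟨(r, c), hq, heq⟩, heq⟩

theorem reach (h : HangsAt d e m K) : ∀ p ∈ K, CellReach K (d - e, e) p := by
  have hle := h.le
  apply cellReach_of_columns
  · intro r c hp
    have := h.bound _ _ hp
    omega
  · intro r r' c hp hr hd
    exact h.closed _ _ _ _ hp hr le_rfl hd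
  · intro r c hp hc
    have := h.bound _ _ hp
    have hn := h.next c hc this.2.1
    exact ⟨hn, h.closed _ _ _ _ hn le_rfl (by omega) (by omega)⟩

theorem lt {e' m' : ℕ} {K' : Set (ℕ × ℕ)} (h : HangsAt d e m K) (h' : HangsAt d e' m' K')
    (he : e + m ≤ e') {p q : ℕ × ℕ} (hp : p ∈ K) (hq : q ∈ K') : q.1 < p.1 ∧ p.2 < q.2 := by
  have h₁ := h.bound _ _ hp
  have h₂ := h'.bound _ _ hq
  omega

end HangsAt

namespace YoungDiagram

variable {Y : YoungDiagram} {n k : ℕ}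

theorem HasSize.exists_hangsAt (hY : Y.HasSize n) (hk : 1 ≤ k) {K : Set (ℕ × ℕ)}
    (hK : K ∈ Y.hangingComponents n k) : ∃ e m, HangsAt (n + k - 1) e m K := by
  set C := (Y.diagCols n (n + k - 1)).filter fun x => (n + k - 1 - x, x) ∈ K with hC
  have hCm : ∀ x, x ∈ C ↔ (n + k - 1 - x, x) ∈ K := fun x => by
    rw [hC, Finset.mem_filter, and_iff_right_iff_imp]
    exact fun hx => hY.mem_diagCols.2 (hY.mem_of_mem_component hK hx).1
  have hcol : ∀ p ∈ K, p.2 ∈ C := fun p hp => (hCm _).2 (hY.component_diag hk hK hp)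
  obtain ⟨p, hp⟩ := nonempty_of_mem_cellComponents hK
  have hne : C.Nonempty := ⟨_, hcol p hp⟩
  have ha := (hCm _).1 (C.min'_mem hne)
  have hb := (hCm _).1 (C.max'_mem hne)
  have hab := C.min'_le_max' hne
  have hbn := hY.snd_lt (hY.mem_of_mem_component hK hb).1
  set a := C.min' hne
  set b := C.max' hne
  simp only at hbn
  refine ⟨a, b + 1 - a, by omega, by omega, ?_, ?_, ?_, ?_⟩
  · intro r c hp
    have h₁ := C.min'_le _ (hcol _ hp)
    have h₂ := C.le_max' _ (hcol _ hp)
    have h₃ := hY.mem_of_mem_component hK hp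
    have h₄ := hY.fst_lt h₃.1
    simp only at h₁ h₂ h₃ h₄
    -- Going left along row r to the antidiagonal stays in the component, so the column reached is
    -- at least the minimum; this bounds r.
    have h₅ := hcol _ (hY.component_closed hK hp le_rfl
      (by omega : n + k - 1 - r ≤ c) (by omega))
    have h₆ := C.min'_le _ h₅
    omega
  · intro r c r' c' hp hr hc hd
    exact hY.component_closed hK hp hr hc (by omega)
  · intro x h₁ h₂
    rcases h₁.eq_or_lt with rfl | h₁
    · exact ha
    · exact (hY.component_between hk hK ha hb h₁ (by omega)).2
  · intro x h₁ h₂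
    rw [Nat.sub_add_cancel (by omega)]
    exact (hY.component_between hk hK ha hb h₁ (by omega)).1

variable {l : ℕ} {S : Fin l → Set (ℕ × ℕ)}

theorem IsComponentList.sum_le_card (hY : Y.HasSize n) (hS : Y.IsComponentList n k S)
    {e m : Fin l → ℕ} (h : ∀ j, HangsAt (n + k - 1) (e j) (m j) (S j)) :
    ∑ j, m j ≤ (Y.diagCols n (n + k - 1)).card := by
  have hc : (Finset.univ.biUnion fun j => Finset.Ico (e j) (e j + m j)).card = ∑ j, m j := by
    rw [Finset.card_biUnion]
    · simp
    · intro a _ b _ hab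
      rw [Function.onFun, Finset.disjoint_left]
      intro x hxa hxb
      rw [Finset.mem_Ico] at hxa hxb
      exact hab (hS.eq_of_mem ((h a).diag x hxa.1 hxa.2) ((h b).diag x hxb.1 hxb.2))
  rw [← hc]
  refine Finset.card_le_card fun x hx => ?_
  obtain ⟨j, -, hx⟩ := Finset.mem_biUnion.1 hx
  rw [Finset.mem_Ico] at hx
  exact hY.mem_diagCols.2 (hY.mem_of_mem_component (hS.mem j) ((h j).diag x hx.1 hx.2)).1

/-- There is an interval of columns, of the size of the lowest antidiagonal of the hanging part, below
which components can be hung without changing the part of `Y` in the staircase. -/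
theorem HasSize.exists_interval (hY : Y.HasSize n) (hc : Y.IsCritical n k) :
    ∃ a, a + (Y.diagCols n (n + k - 1)).card ≤ n ∧ n + k - 1 < n + a ∧
      ∀ x, a ≤ x → x < a + (Y.diagCols n (n + k - 1)).card →
        ∀ r c, r + x ≤ n + k - 1 → c ≤ x → r + c < n + k - 1 → (r, c) ∈ Y := by
  have hk := hc.1.1
  obtain ⟨K, hK, -⟩ := hc.1.2
  obtain ⟨p, hp⟩ := nonempty_of_mem_cellComponents hK
  have hne : (Y.diagCols n (n + k - 1)).Nonempty :=
    ⟨_, hY.mem_diagCols_of_mem_hanging (subset_of_mem_cellComponents hK hp)⟩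
  set C := Y.diagCols n (n + k - 1) with hC
  have ha := C.min'_mem hne
  have hb := C.max'_mem hne
  have hcard : C.card ≤ C.max' hne + 1 - C.min' hne := by
    rw [← Nat.card_Icc]
    refine Finset.card_le_card fun x hx => ?_
    exact Finset.mem_Icc.2 ⟨C.min'_le x hx, C.le_max' x hx⟩
  have hab := C.min'_le_max' hne
  have h₁ := hY.fst_lt (hY.mem_diagCols.1 ha)
  have h₂ := hY.snd_lt (hY.mem_diagCols.1 hb)
  simp only at h₁ h₂
  refine ⟨C.min' hne, by omega, by omega, ?_⟩
  intro x hx hx' r c hr hcx hlt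
  -- For k = 1 the required cells lie in the staircase contained in `Y`. For larger k the previous
  -- complement is connected, so the antidiagonal cells of `Y` are consecutive and have the required
  -- cells above and to their left.
  rcases hk.eq_or_lt with rfl | hk1
  · exact hY.2.2 r c (by omega)
  · have hsub := hc.subsingleton (k' := k - 1) (by omega) (by omega)
    have hbet := hY.diagCols_between (k := k - 1) (by omega) hsub (x := C.min' hne)
      (y := C.max' hne) (z := x)
    rw [show n + (k - 1) = n + k - 1 by omega] at hbet
    have := hY.mem_diagCols.1 (hbet ha hb hx (by omega))
    exact Y.up_left_mem (by omega) hcx this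

theorem exists_isRearrangement (hY : Y.HasSize n) (hc : Y.IsCritical n k)
    (hS : Y.IsComponentList n k S) (τ : Equiv.Perm (Fin l)) (t : Fin l → Bool) :
    ∃ Y' : YoungDiagram, Y'.IsRearrangement Y n k S τ t := by
  have hk := hc.1.1
  choose e m hem using fun j => hY.exists_hangsAt hk (hS.mem j)
  have hsum : ∑ j, m (τ j) ≤ (Y.diagCols n (n + k - 1)).card := by
    rw [Equiv.sum_comp τ m]
    exact hS.sum_le_card hY hem
  obtain ⟨a, han, hna, hint⟩ := hY.exists_interval hc
  set d := n + k - 1 with hd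
  -- The components are packed without gaps from column a on; component j starts after the widths of
  -- its predecessors.
  set e' : Fin l → ℕ := fun j => a + ∑ i ∈ Finset.Iio j, m (τ i) with he'
  have hins : ∀ j, e' j + m (τ j) = a + ∑ i ∈ insert j (Finset.Iio j), m (τ i) := by
    intro j
    rw [Finset.sum_insert Finset.notMem_Iio_self]
    simp only [he']
    omega
  have hle : ∀ j, e' j + m (τ j) ≤ a + ∑ i, m (τ i) := by
    intro j
    rw [hins]
    exact Nat.add_le_add_left (Finset.sum_le_sum_of_subset (Finset.subset_univ _)) _
  have hlt : ∀ i j, i < j → e' i + m (τ i) ≤ e' j := by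
    intro i j hij
    rw [hins]
    refine Nat.add_le_add_left (Finset.sum_le_sum_of_subset fun x hx => ?_) _
    rw [Finset.mem_insert, Finset.mem_Iio] at hx
    rw [Finset.mem_Iio]
    rcases hx with rfl | hx
    exacts [hij, hx.trans hij]
  have hae : ∀ j, a ≤ e' j := fun j => Nat.le_add_right _ _
  have hex : ∀ j, ∃ K, HangsAt d (e' j) (m (τ j)) K ∧
      IsTranslate K (transposeIf (t j) (S (τ j))) := by
    intro j
    obtain ⟨b, hb⟩ := (hem (τ j)).transposeIf (t j)
    have := hle j
    exact hb.exists_translate (by omega)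
  choose S' hS' htr using hex
  have hbound : ∀ j r c, (r, c) ∈ S' j → r < n ∧ c < n ∧ d ≤ r + c := by
    intro j r c hp
    have h₁ := (hS' j).bound r c hp
    have h₂ := hle j
    have h₃ := hae j
    omega
  let Y' : YoungDiagram :=
    { cells := (Finset.range n ×ˢ Finset.range n).filter fun p =>
        (p ∈ Y ∧ p.1 + p.2 < d) ∨ ∃ j, p ∈ S' j
      isLowerSet := by
        rintro ⟨r, c⟩ ⟨r', c'⟩ ⟨hr, hc⟩ hp
        simp only [Finset.coe_filter, Finset.mem_product, Finset.mem_range, Set.mem_ofPred_eq]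
          at hp hr hc ⊢
        refine ⟨by omega, ?_⟩
        rcases hp.2 with ⟨h, hlt⟩ | ⟨j, hj⟩
        · exact Or.inl ⟨Y.up_left_mem hr hc h, by omega⟩
        · have h₁ := (hS' j).bound r c hj
          have h₂ := hle j
          have h₃ := hae j
          rcases le_or_gt d (r' + c') with hd' | hd'
          · exact Or.inr ⟨j, (hS' j).closed _ _ _ _ hj hr hc hd'⟩
          -- Column max c' (d - r) lies in the span of component j, and its antidiagonal cell is
          -- weakly below and to the right of (r', c').
          · exact Or.inl ⟨hint (max c' (d - r)) (by omega) (by omega) r' c' (by omega) (by omega)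
              hd', hd'⟩ }
  have hmem : ∀ p, p ∈ Y' ↔ (p ∈ Y ∧ p.1 + p.2 < d) ∨ ∃ j, p ∈ S' j := by
    intro p
    change p ∈ Finset.filter _ _ ↔ _
    rw [Finset.mem_filter, and_iff_right_iff_imp, Finset.mem_product, Finset.mem_range,
      Finset.mem_range]
    rintro (⟨h, -⟩ | ⟨j, hj⟩)
    · exact ⟨hY.fst_lt h, hY.snd_lt h⟩
    · exact ⟨(hbound j _ _ hj).1, (hbound j _ _ hj).2.1⟩
  have hstair : ∀ i j, i + j < n → (i, j) ∈ Y' := fun i j hij =>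
    (hmem _).2 (Or.inl ⟨hY.2.2 i j hij, by simp only; omega⟩)
  have hfst : ∀ p ∈ Y', p.1 < n ∧ p.2 < n := fun p hp => by
    rcases (hmem p).1 hp with ⟨h, -⟩ | ⟨j, hj⟩
    · exact ⟨hY.fst_lt h, hY.snd_lt h⟩
    · exact ⟨(hbound j _ _ hj).1, (hbound j _ _ hj).2.1⟩
  have hY' : Y'.HasSize n := by
    refine ⟨?_, ?_, hstair⟩
    · refine eq_of_forall_lt_iff fun i => ?_
      rw [← Y'.mem_iff_lt_colLen]
      exact ⟨fun h => (hfst _ h).1, fun h => hstair _ _ (by omega)⟩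
    · refine eq_of_forall_lt_iff fun i => ?_
      rw [← Y'.mem_iff_lt_rowLen]
      exact ⟨fun h => (hfst _ h).2, fun h => hstair _ _ (by omega)⟩
  have hlt' : ∀ i j, i < j → ∀ p ∈ S' i, ∀ q ∈ S' j, q.1 < p.1 ∧ p.2 < q.2 :=
    fun i j hij p hp q hq => (hS' i).lt (hS' j) (hlt i j hij) hp hq
  refine ⟨Y', hY', ?_, S', ⟨?_, hlt'⟩, htr⟩
  · ext p
    simp only [Set.mem_inter_iff, Finset.mem_coe, mem_cells, and_congr_left_iff]
    rintro ⟨h₁, h₂, h₃⟩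
    rw [hmem]
    constructor
    · rintro (⟨h, -⟩ | ⟨j, hj⟩)
      · exact h
      · have := (hbound j _ _ hj).2.2
        omega
    · exact fun h => Or.inl ⟨h, by omega⟩
  · have hunion : Y'.hanging n k = ⋃ j, S' j := by
      ext p
      rw [hY'.mem_hanging, hmem, Set.mem_iUnion]
      constructor
      · rintro ⟨⟨-, h⟩ | h, h'⟩
        · omega
        · exact h
      · rintro ⟨j, hj⟩
        have := (hbound j _ _ hj).2.2
        exact ⟨Or.inr ⟨j, hj⟩, by omega⟩
    change _ = cellComponents (Y'.hanging n k)
    rw [hunion, cellComponents_iUnion S' (fun j => (d - e' j, e' j))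
      (fun j => (hS' j).diag _ le_rfl (by have := (hS' j).pos; omega)) fun j => (hS' j).reach]
    intro i j hij p hp q hq hadj
    rcases lt_or_gt_of_ne hij with h | h
    · exact not_hasse_adj_of_lt (hlt' i j h p hp q hq).1 (hlt' i j h p hp q hq).2 hadj
    · exact not_hasse_adj_of_lt (hlt' j i h q hq p hp).1 (hlt' j i h q hq p hp).2 hadj.symm

end YoungDiagram

theorem mainTheorem5 (n : ℕ) (Y : YoungDiagram) (hY : Y.HasSize n)
    (k : ℕ) (hk : Y.IsCritical n k)
    (l : ℕ) (S : Fin l → Set (ℕ × ℕ)) (hS : Y.IsComponentList n k S)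
    (τ : Equiv.Perm (Fin l)) (t : Fin l → Bool) :
    (∃ Y' : YoungDiagram, Y'.IsRearrangement Y n k S τ t) ∧
      ∀ Y' : YoungDiagram, Y'.IsRearrangement Y n k S τ t →
        Y'.IsCritical n k ∧ Y'.numAvoiding pattern213 = Y.numAvoiding pattern213 :=
  ⟨YoungDiagram.exists_isRearrangement hY hk hS τ t, fun _ h =>
    ⟨hk.of_isRearrangement hY hS h, YoungDiagram.numAvoiding_eq_of_isRearrangement hY hk hS h⟩⟩
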